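/- **Theorem 2.1.** Let $d>0$ be a fundamental discriminant, i.e. either $d\equiv 1 \pmod 4$ is squarefree, or $d=4m$ with $m\equiv 2,3\pmod 4$ squarefree, and let $\chi_d=\left(\frac{d}{\cdot}\right)$ be the associated (Kronecker symbol) quadratic Dirichlet character modulo $d$, which is even. Let $\tau(n)$ be Ramanujan's function, $\eta(z)^{24}=\sum_{n\ge 1}\tau(n)e^{2\pi i n z}$ with $\eta$ the Dedekind eta function, put $\tau^*(n)=\tau(n)/n^{11/2}$, and let $L_\Delta(s,\chi_d)$ be the entire function that equals $\sum_{n\ge1}\chi_d(n)\tau^*(n)n^{-s}$ for $\mathrm{Re}(s)>1$. Let $$\xi_\Delta(s,\chi_d)=\left(\frac{d}{2\pi}\right)^{s}\Gamma\!\left(s+\tfrac{11}{2}\right)L_\Delta(s,\chi_d).$$ Assume the Riemann hypothesis for $L_\Delta(s,\chi_d)$: every zero of $\xi_\Delta(s,\chi_d)$ that is not a pole of $\Gamma(s+\tfrac{11}{2})$ has real part $\tfrac12$. Let $\phi:\mathbb R\to\mathbb C$ be an even Schwartz function whose Fourier transform $\widehat\phi(\omega)=\int_{\mathbb R}\phi(x)e^{2\pi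 i x\omega}\,dx$ has compact support, extend $\phi$ to the complex plane by $\phi(z)=\int_{\mathbb R}\widehat\phi(\omega)e^{2\pi i \omega z}\,d\omega$, and set $H(s)=\phi\!\left(\frac{s-1/2}{i}\right)$. Then $\xi_\Delta(s,\chi_d)$ has no zeros on $\mathrm{Re}(s)=\tfrac32$, and $$\sum_{\gamma_d}\phi(\gamma_d)=\frac{1}{2\pi i}\int_{\mathrm{Re}(s)=3/2}\frac{\xi_\Delta'(s,\chi_d)}{\xi_\Delta(s,\chi_d)}\,\bigl[H(s)+H(1-s)\bigr]\,ds,$$ where the sum is over all zeros $\tfrac12+i\gamma_d$ of $\xi_\Delta(s,\chi_d)$, counted with multiplicity, the line is traversed upwards, and both the sum and the integral converge absolutely. -/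

import Mathlib

open scoped FourierTransform

noncomputable section

namespace TauTwist

/-- `d` is a fundamental discriminant: either `d ≡ 1 (mod 4)` is squarefree, or `d = 4m` with
`m ≡ 2, 3 (mod 4)` squarefree. -/
def IsFundamentalDiscriminant (d : ℤ) : Prop :=
  (d % 4 = 1 ∧ Squarefree d) ∨
    ∃ m : ℤ, d = 4 * m ∧ (m % 4 = 2 ∨ m % 4 = 3) ∧ Squarefree m

/-- The Kronecker symbol `(d / n)` for `n ∈ ℕ`. Writing `n = 2 ^ k * n'` with `n'` odd it is
`(d / 2) ^ k` times the Jacobi symbol `(d / n')`, where `(d / 2)` is `0` for `d` even, `1` for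
`d ≡ ±1 (mod 8)` and `-1` for `d ≡ ±3 (mod 8)`; these are the values of `ZMod.χ₈`.
For `d > 0` a fundamental discriminant, `n ↦ (d / n)` is the primitive quadratic Dirichlet
character `χ_d` modulo `d`. -/
def kroneckerSymbol (d : ℤ) (n : ℕ) : ℤ :=
  if n = 0 then (if d = 1 ∨ d = -1 then 1 else 0)
  else ZMod.χ₈ (d : ZMod 8) ^ n.factorization 2 * jacobiSym d (n / 2 ^ n.factorization 2)

/-- Ramanujan's `τ(n)`: the `n`-th coefficient of the expansion of `η(z) ^ 24` in powers of
`q = exp (2 π i z)`. (`ModularForm.discriminant` is `η ^ 24` by definition.) -/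
def tau (n : ℕ) : ℂ :=
  (UpperHalfPlane.qExpansion 1 ModularForm.discriminant).coeff n

/-- `τ*(n) = τ(n) / n ^ (11/2)`. -/
def tauStar (n : ℕ) : ℂ := tau n / (n : ℂ) ^ (11 / 2 : ℂ)

/-- The Dirichlet series `∑_{n ≥ 1} χ_d(n) τ*(n) / n ^ s`. -/
def twistedTauSeries (d : ℤ) (s : ℂ) : ℂ :=
  LSeries (fun n ↦ (kroneckerSymbol d n : ℂ) * tauStar n) s

open Classical in
/-- `L_Δ(s, χ_d)`: the (unique) entire function which is equal to the Dirichlet series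
`∑ χ_d(n) τ*(n) / n ^ s` for `Re s > 1`. -/
def twistedTauL (d : ℤ) : ℂ → ℂ :=
  if h : ∃ F : ℂ → ℂ, Differentiable ℂ F ∧ ∀ s : ℂ, 1 < s.re → F s = twistedTauSeries d s
  then h.choose
  else twistedTauSeries d

/-- `ξ_Δ(s, χ_d) = (d / 2π) ^ s Γ(s + 11/2) L_Δ(s, χ_d)`. This formula is meaningful away from the
poles of `Γ(s + 11/2)`, see `IsGammaPole`; those points are removable singularities of `ξ_Δ`,
and this function is used only away from them. -/
def xi (d : ℤ) (s : ℂ) : ℂ :=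
  ((d : ℂ) / (2 * (Real.pi : ℂ))) ^ s * Complex.Gamma (s + 11 / 2) * twistedTauL d s

/-- `s` is a pole of `Γ(s + 11/2)`, that is `s + 11/2 ∈ {0, -1, -2, …}`. -/
def IsGammaPole (s : ℂ) : Prop := ∃ n : ℕ, s + 11 / 2 = -(n : ℂ)

/-- The Riemann hypothesis for `L_Δ(s, χ_d)`: all zeros of `ξ_Δ(s, χ_d)`, i.e. all nontrivial zeros
of `L_Δ(s, χ_d)`, have real part `1/2`. -/
def RiemannHypothesisFor (d : ℤ) : Prop :=
  ∀ s : ℂ, ¬ IsGammaPole s → xi d s = 0 → s.re = 1 / 2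

/-- The set of real `γ` such that `1/2 + iγ` is a zero of `ξ_Δ(s, χ_d)`. -/
def zeroOrdinates (d : ℤ) : Set ℝ :=
  {γ : ℝ | xi d (1 / 2 + (γ : ℂ) * Complex.I) = 0}

/-- The multiplicity of `1/2 + iγ` as a zero of `ξ_Δ(s, χ_d)`. -/
def zeroMultiplicity (d : ℤ) (γ : ℝ) : ℕ :=
  analyticOrderNatAt (xi d) (1 / 2 + (γ : ℂ) * Complex.I)

/-- The extension of `φ` to the complex plane, `φ(z) = ∫ φ̂(ω) exp (2 π i ω z) dω`, for a Schwartz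
function `φ` whose Fourier transform is compactly supported. -/
def complexExtension (φ : SchwartzMap ℝ ℂ) (z : ℂ) : ℂ :=
  ∫ ω : ℝ, (𝓕 φ) ω * Complex.exp (2 * (Real.pi : ℂ) * Complex.I * (ω : ℂ) * z)

/-- On the real line the extension is the original function. -/
theorem complexExtension_ofReal (φ : SchwartzMap ℝ ℂ) (x : ℝ) :
    complexExtension φ (x : ℂ) = φ x := by
  have h : (𝓕⁻ (𝓕 φ)) x = φ x := by rw [FourierTransform.fourierInv_fourier_eq]
  rw [← h, SchwartzMap.fourierInv_coe, Real.fourierInv_eq']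
  unfold complexExtension
  refine MeasureTheory.integral_congr_ae (Filter.Eventually.of_forall fun ω ↦ ?_)
  simp only [smul_eq_mul]
  rw [mul_comm]
  congr 2
  simp
  ring

/-- `H(s) = φ((s - 1/2) / i)`. -/
def weightH (φ : SchwartzMap ℝ ℂ) (s : ℂ) : ℂ :=
  complexExtension φ ((s - 1 / 2) / Complex.I)

/-- The integrand `(ξ_Δ' / ξ_Δ)(s, χ_d) [H(s) + H(1 - s)]`. -/
def explicitIntegrand (d : ℤ) (φ : SchwartzMap ℝ ℂ) (s : ℂ) : ℂ :=
  deriv (xi d) s / xi d s * (weightH φ s + weightH φ (1 - s))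

/-- The upward line integral `∫_{Re s = c} F(s) ds`. -/
def verticalIntegral (c : ℝ) (F : ℂ → ℂ) : ℂ :=
  ∫ t : ℝ, F ((c : ℂ) + (t : ℂ) * Complex.I) * Complex.I

end TauTwist

end

/-! ### Zeros and logarithmic derivatives of entire functions of order at most two -/

namespace EntireFunction

open Complex Set Filter Topology Metric

/-! The proof replaces `xi d` by an entire function, `completedTwist χ`, and applies a contour
argument that uses only symmetry, growth and the location of zeros.

Arithmetic side. On the imaginary axis the twist of Δ by χ is a series `twistedDelta χ t`. A Gauss
sum rewrites it as a finite combination of the values Δ((a + it)/D), and modularity of Δ under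
matrices with lower row (D, -a) gives f(1/t) = t^12 f(t), with sign +1 because χ is primitive,
quadratic and even. The Mellin transform of f is therefore entire, symmetric under s ↦ 1 - s after
the shift by 11/2, and bounded by exp(A(1 + |s|)^2). A Parseval estimate for τ gives absolute
convergence of the Dirichlet series for Re s > 1, which identifies the Mellin transform with `xi d`
away from the gamma poles.

Analytic side. Order at most two yields O(R^2) zeros in a disc of radius R and polynomial bounds for
the logarithmic derivative, on Re s = 3/2 and on suitable horizontal segments. The weight H decays
faster than any power in the strip, since φ̂ is smooth with compact support. Integrate H ξ'/ξ around
[-1/2, 3/2] × [-T, T]: the horizontal sides vanish in the limit, and s ↦ 1 - s makes the left side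
contribute as much as the right. This doubling is the factor H(s) + H(1 - s) = 2H(s). The key
results are `exists_factorization`, `hasSum_zeros`, `twistedDelta_one_div` and `twistedTauL_eq`. -/

theorem analyticOrderAt_ne_top {f : ℂ → ℂ} (hf : Differentiable ℂ f) {c : ℂ} (hc : f c ≠ 0)
    (z : ℂ) : analyticOrderAt f z ≠ ⊤ := by
  intro h
  rw [AnalyticOnNhd.analyticOrderAt_eq_top_iff_eq_zero z fun w ↦ hf.analyticAt w] at h
  exact hc (by simp [h])

/-- Splitting off a zero of an entire function. -/
theorem exists_eq_pow_mul {f : ℂ → ℂ} (hf : Differentiable ℂ f) {c : ℂ} (hc : f c ≠ 0) (ρ : ℂ) :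
    ∃ g : ℂ → ℂ, Differentiable ℂ g ∧ g ρ ≠ 0 ∧
      ∀ z, f z = (z - ρ) ^ analyticOrderNatAt f ρ * g z := by
  obtain ⟨g₀, hg₀, hg₀ne, heq⟩ := (hf.analyticAt ρ).analyticOrderAt_ne_top.1
    (analyticOrderAt_ne_top hf hc ρ)
  set m := analyticOrderNatAt f ρ
  let g : ℂ → ℂ := Function.update (fun z ↦ f z / (z - ρ) ^ m) ρ (g₀ ρ)
  have hg_eq : g =ᶠ[𝓝 ρ] g₀ := by
    filter_upwards [heq] with z hz
    rcases eq_or_ne z ρ with rfl | hzρ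
    · simp [g]
    · have : (z - ρ) ^ m ≠ 0 := pow_ne_zero _ (sub_ne_zero.2 hzρ)
      simp [g, hzρ, hz, this]
  refine ⟨g, fun z ↦ ?_, by simpa [g] using hg₀ne, fun z ↦ ?_⟩
  · rcases eq_or_ne z ρ with rfl | hzρ
    · exact hg₀.differentiableAt.congr_of_eventuallyEq hg_eq
    · have h1 : g =ᶠ[𝓝 z] fun z ↦ f z / (z - ρ) ^ m := by
        filter_upwards [isOpen_ne.mem_nhds hzρ] with w hw
        simp [g, Function.update_of_ne hw]
      refine DifferentiableAt.congr_of_eventuallyEq ?_ h1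
      exact (hf z).div (by fun_prop) (pow_ne_zero _ (sub_ne_zero.2 hzρ))
  · rcases eq_or_ne z ρ with rfl | hzρ
    · simpa [g] using heq.self_of_nhds
    · have : (z - ρ) ^ m ≠ 0 := pow_ne_zero _ (sub_ne_zero.2 hzρ)
      simp only [g, Function.update_of_ne hzρ]
      field_simp

/-- Splitting off finitely many zeros of an entire function. -/
theorem exists_eq_prod_mul {f : ℂ → ℂ} (hf : Differentiable ℂ f) {c : ℂ} (hc : f c ≠ 0)
    (S : Finset ℂ) :
    ∃ g : ℂ → ℂ, Differentiable ℂ g ∧ (∀ ρ ∈ S, g ρ ≠ 0) ∧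
      ∀ z, f z = (∏ ρ ∈ S, (z - ρ) ^ analyticOrderNatAt f ρ) * g z := by
  induction S using Finset.induction_on with
  | empty => exact ⟨f, hf, by simp, by simp⟩
  | insert a S ha ih =>
    obtain ⟨g, hg, hgne, hfg⟩ := ih
    have hgc : g c ≠ 0 := fun h ↦ hc (by rw [hfg, h, mul_zero])
    obtain ⟨k, hk, hka, hgk⟩ := exists_eq_pow_mul hg hgc a
    let P : ℂ → ℂ := fun z ↦ ∏ ρ ∈ S, (z - ρ) ^ analyticOrderNatAt f ρ
    have hP : Differentiable ℂ P := by fun_prop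
    have hPa : P a ≠ 0 := by
      simp only [P, Finset.prod_ne_zero_iff]
      intro ρ hρ
      exact pow_ne_zero _ (sub_ne_zero.2 fun h ↦ ha (h ▸ hρ))
    have hord : analyticOrderNatAt f a = analyticOrderNatAt g a := by
      have h1 : f = P * g := funext fun z ↦ hfg z
      rw [analyticOrderNatAt, analyticOrderNatAt, h1,
        analyticOrderAt_mul (hP.analyticAt a) (hg.analyticAt a),
        (hP.analyticAt a).analyticOrderAt_eq_zero.2 hPa, zero_add]
    refine ⟨k, hk, fun ρ hρ ↦ ?_, fun z ↦ ?_⟩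
    · rcases Finset.mem_insert.1 hρ with rfl | hρ
      · exact hka
      · intro h
        exact hgne ρ hρ (by rw [hgk, h, mul_zero])
    · rw [Finset.prod_insert ha, hfg z, hgk z, hord]
      ring

theorem finite_zeros_inter_closedBall {f : ℂ → ℂ} (hf : Differentiable ℂ f) {c : ℂ} (hc : f c ≠ 0)
    (a : ℂ) (R : ℝ) : {z | f z = 0 ∧ dist z a ≤ R}.Finite := by
  have h1 : f ⁻¹' {0}ᶜ ∈ codiscrete ℂ :=
    AnalyticOnNhd.preimage_zero_mem_codiscrete (fun z _ ↦ hf.analyticAt z) hc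
  have h2 := (isCompact_closedBall a R).finite_sdiff_of_mem_codiscreteWithin
    (codiscreteWithin_mono (subset_univ _) h1)
  refine h2.subset fun z hz ↦ ?_
  simpa [and_comm] using hz

/-- A bound for the logarithmic derivative of a holomorphic function without zeros. -/
theorem norm_logDeriv_le {g : ℂ → ℂ} {c : ℂ} {R L : ℝ} (hR : 0 < R) (hL : 0 < L)
    (hg : DifferentiableOn ℂ g (ball c R)) (hne : ∀ z ∈ ball c R, g z ≠ 0)
    (hbd : ∀ z ∈ ball c R, ‖g z‖ ≤ ‖g c‖ * Real.exp L) {z : ℂ} (hz : dist z c ≤ R / 2) :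
    ‖logDeriv g z‖ ≤ 24 * L / R := by
  have hlog : DifferentiableOn ℂ (logDeriv g) (ball c R) := by
    have : DifferentiableOn ℂ (deriv g) (ball c R) := hg.deriv isOpen_ball
    exact this.div hg hne
  -- A primitive of g'/g vanishing at c is a branch of log(g / g c); the size bound on g becomes Re
  -- G ≤ L.
  obtain ⟨G, hGc, hG⟩ := hlog.isExactOn_ball.with_val_at c 0
  have hcm : c ∈ ball c R := mem_ball_self hR
  -- `g = g c * exp G`
  have hexp : ∀ w ∈ ball c R, g w = g c * exp (G w) := by
    have hd : ∀ w ∈ ball c R, HasDerivAt (fun w ↦ g w * exp (-G w)) 0 w := by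
      intro w hw
      have h1 := (hg.differentiableAt (isOpen_ball.mem_nhds hw)).hasDerivAt
      have h2 := (hG w hw).neg.cexp
      convert! h1.mul h2 using 1
      have := hne w hw
      simp only [logDeriv_apply]
      field_simp
      ring
    intro w hw
    have := (convex_ball c R).is_const_of_fderivWithin_eq_zero (𝕜 := ℂ)
      (f := fun w ↦ g w * exp (-G w))
      (fun x hx ↦ (hd x hx).differentiableAt.differentiableWithinAt)
      (fun x hx ↦ by
        rw [fderivWithin_of_isOpen isOpen_ball hx]
        ext
        simp [(hd x hx).hasFDerivAt.fderiv]) hw hcm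
    simp only [hGc, neg_zero, exp_zero, mul_one] at this
    rw [← this, mul_assoc, ← exp_add]
    simp
  have hgc : 0 < ‖g c‖ := norm_pos_iff.2 (hne c hcm)
  have hre : ∀ w ∈ ball c R, (G w).re ≤ L := by
    intro w hw
    have := hbd w hw
    rw [hexp w hw, norm_mul, norm_exp] at this
    exact Real.exp_le_exp.1 (le_of_mul_le_mul_left this hgc)
  have hGd : DifferentiableOn ℂ G (ball c R) := fun w hw ↦
    (hG w hw).differentiableAt.differentiableWithinAt
  -- Borel–Carathéodory gives 2Lr/(R - r), which is 6L at r = 3R/4.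
  have hBC : ∀ w, dist w c ≤ 3 * R / 4 → ‖G w‖ ≤ 6 * L := by
    intro w hw
    have hmaps : MapsTo (fun u ↦ c + u) (ball 0 R) (ball c R) := fun u hu ↦ by simpa using hu
    have hwR : w - c ∈ ball (0 : ℂ) R := by
      simp only [mem_ball, dist_zero_right, ← dist_eq_norm]; linarith
    have := borelCaratheodory_zero (f := fun u ↦ G (c + u)) (M := L) hL
      (hGd.comp (by fun_prop) hmaps) (fun u hu ↦ hre _ (hmaps hu)) hR hwR (by simpa using hGc)
    simp only [add_sub_cancel] at this
    rw [dist_eq_norm] at hw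
    refine this.trans ?_
    rw [div_le_iff₀ (by linarith)]
    nlinarith
  have hderiv : logDeriv g z = deriv G z := by
    refine (hG z ?_).deriv.symm
    rw [mem_ball]; linarith
  have hsub : closedBall z (R / 4) ⊆ ball c R := fun w hw ↦ by
    rw [mem_closedBall] at hw
    rw [mem_ball]
    linarith [dist_triangle w z c]
  rw [hderiv]
  -- Cauchy's estimate on a circle of radius R/4 about z, still within 3R/4 of c, gives 6L/(R/4) =
  -- 24L/R.
  have := norm_deriv_le_of_forall_mem_sphere_norm_le (c := z) (R := R / 4) (C := 6 * L) (f := G)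
    (by linarith)
    ((hGd.mono hsub).diffContOnCl_ball subset_rfl) (fun w hw ↦ hBC w ?_)
  · refine this.trans (le_of_eq ?_)
    field_simp
    norm_num
  · rw [mem_sphere] at hw
    linarith [dist_triangle w z c]

/-- For an entire function of order at most two: local factorization on large discs, with control
on the number of zeros and on the logarithmic derivative of the zero-free factor. -/
theorem exists_factorization {f : ℂ → ℂ} (hf : Differentiable ℂ f) {c : ℂ} (hc : f c ≠ 0)
    {A : ℝ} (hA : ∀ z, ‖f z‖ ≤ Real.exp (A * (1 + ‖z‖) ^ 2)) :
    ∃ K : ℝ, 0 < K ∧ ∀ R : ℝ, 1 ≤ R → ∃ (S : Finset ℂ) (g : ℂ → ℂ),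
      (∀ z, z ∈ S ↔ f z = 0 ∧ dist z c ≤ R) ∧
      (∑ ρ ∈ S, (analyticOrderNatAt f ρ : ℝ)) ≤ K * R ^ 2 ∧
      Differentiable ℂ g ∧ (∀ z, dist z c ≤ R → g z ≠ 0) ∧
      (∀ z, f z = (∏ ρ ∈ S, (z - ρ) ^ analyticOrderNatAt f ρ) * g z) ∧
      ∀ z, dist z c ≤ R / 2 → ‖logDeriv g z‖ ≤ K * R ^ 2 := by
  have hfc : 0 < ‖f c‖ := norm_pos_iff.2 hc
  set B : ℝ := |A| * (4 + ‖c‖) ^ 2 + |Real.log ‖f c‖| + 1 with hB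
  have hBpos : 0 < B := by positivity
  have hbound : ∀ R : ℝ, 1 ≤ R → ∀ z, dist z c ≤ 3 * R → ‖f z‖ ≤ ‖f c‖ * Real.exp (B * R ^ 2) := by
    intro R hR z hz
    refine (hA z).trans ?_
    have h1 : ‖z‖ ≤ 3 * R + ‖c‖ := by
      have := norm_sub_norm_le z c
      rw [dist_eq_norm] at hz
      linarith
    have hR2 : 1 ≤ R ^ 2 := one_le_pow₀ hR
    have h2 : A * (1 + ‖z‖) ^ 2 ≤ |A| * (4 + ‖c‖) ^ 2 * R ^ 2 := by
      rw [mul_assoc, ← mul_pow]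
      refine mul_le_mul (le_abs_self A) ?_ (by positivity) (abs_nonneg A)
      refine pow_le_pow_left₀ (by positivity) ?_ 2
      nlinarith [norm_nonneg c]
    have h3 : Real.log ‖f c‖ + B * R ^ 2 ≥ A * (1 + ‖z‖) ^ 2 := by
      have h4 := neg_abs_le (Real.log ‖f c‖)
      have h5 : |Real.log ‖f c‖| * 1 ≤ |Real.log ‖f c‖| * R ^ 2 := by gcongr
      rw [hB]
      nlinarith
    calc Real.exp (A * (1 + ‖z‖) ^ 2) ≤ Real.exp (Real.log ‖f c‖ + B * R ^ 2) :=
          Real.exp_le_exp.2 h3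
      _ = _ := by rw [Real.exp_add, Real.exp_log hfc]
  -- The constant 24 is that of `norm_logDeriv_le`; the zero count would only need 2B.
  refine ⟨24 * B, by positivity, fun R hR ↦ ?_⟩
  have hR0 : 0 < R := by linarith
  let S : Finset ℂ := (finite_zeros_inter_closedBall hf hc c R).toFinset
  have hS : ∀ z, z ∈ S ↔ f z = 0 ∧ dist z c ≤ R := fun z ↦ by simp [S]
  obtain ⟨g, hg, hgS, hfg⟩ := exists_eq_prod_mul hf hc S
  have hgne : ∀ z, dist z c ≤ R → g z ≠ 0 := by
    intro z hz h
    exact hgS z ((hS z).2 ⟨by rw [hfg, h, mul_zero], hz⟩) h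
  set m : ℂ → ℕ := analyticOrderNatAt f
  set Q : ℂ → ℂ := fun z ↦ ∏ ρ ∈ S, (z - ρ) ^ m ρ with hQ
  have hQc : Q c ≠ 0 := fun h ↦ hc (by rw [hfg]; simp only [hQ] at h; rw [h, zero_mul])
  -- On this circle a zero in the disc of radius R is at distance at least 2R, twice its distance
  -- from c. Each zero thus costs a factor 2 in growth, as in Jensen's inequality.
  have hQlow : ∀ z, dist z c = 3 * R → 2 ^ (∑ ρ ∈ S, m ρ) * ‖Q c‖ ≤ ‖Q z‖ := by
    intro z hz
    simp only [hQ, norm_prod, norm_pow]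
    rw [← Finset.prod_pow_eq_pow_sum, ← Finset.prod_mul_distrib]
    refine Finset.prod_le_prod (fun _ _ ↦ by positivity) fun ρ hρ ↦ ?_
    rw [← mul_pow]
    refine pow_le_pow_left₀ (by positivity) ?_ _
    have h1 := ((hS ρ).1 hρ).2
    rw [← dist_eq_norm, ← dist_eq_norm, dist_comm c ρ]
    linarith [dist_triangle z ρ c]
  -- the maximum principle for the zero-free factor
  have hgmax : ∀ z, dist z c ≤ 3 * R →
      2 ^ (∑ ρ ∈ S, m ρ) * ‖g z‖ ≤ ‖g c‖ * Real.exp (B * R ^ 2) := by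
    intro z hz
    have h2 : (0 : ℝ) < 2 ^ (∑ ρ ∈ S, m ρ) := by positivity
    rw [mul_comm, ← le_div_iff₀ h2]
    refine norm_le_of_forall_mem_frontier_norm_le (U := ball c (3 * R)) isBounded_ball
      hg.diffContOnCl (fun w hw ↦ ?_) ?_
    · rw [frontier_ball _ (by linarith), mem_sphere] at hw
      have h3 := hbound R hR w hw.le
      have h4 := hQlow w hw
      rw [hfg w, hfg c, norm_mul, norm_mul] at h3
      change ‖Q w‖ * ‖g w‖ ≤ ‖Q c‖ * ‖g c‖ * _ at h3
      have hQc' : 0 < ‖Q c‖ := norm_pos_iff.2 hQc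
      rw [le_div_iff₀ h2]
      refine le_of_mul_le_mul_left ?_ hQc'
      calc ‖Q c‖ * (‖g w‖ * 2 ^ (∑ ρ ∈ S, m ρ)) = (2 ^ (∑ ρ ∈ S, m ρ) * ‖Q c‖) * ‖g w‖ := by ring
        _ ≤ ‖Q w‖ * ‖g w‖ := by gcongr
        _ ≤ _ := h3
        _ = _ := by ring
    · rw [closure_ball _ (by linarith)]
      exact hz
  have hgc : 0 < ‖g c‖ := norm_pos_iff.2 (hgne c (by simpa using hR0.le))
  refine ⟨S, g, hS, ?_, hg, hgne, hfg, fun z hz ↦ ?_⟩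
  · have h1 := hgmax c (by simpa using hR0.le)
    have h2 : (2 : ℝ) ^ (∑ ρ ∈ S, m ρ) ≤ Real.exp (B * R ^ 2) := by
      refine le_of_mul_le_mul_left ?_ hgc
      linarith
    have h3 := Real.log_le_log (by positivity) h2
    rw [Real.log_exp, Real.log_pow] at h3
    have h4 : (1 / 2 : ℝ) ≤ Real.log 2 := by linarith [Real.log_two_gt_d9]
    push_cast at h3 ⊢
    have h5 : (0 : ℝ) ≤ ∑ ρ ∈ S, (m ρ : ℝ) := by positivity
    have h6 : 0 ≤ B * R ^ 2 := by positivity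
    nlinarith
  · have h1 := norm_logDeriv_le (g := g) (c := c) (R := R) (L := B * R ^ 2) hR0 (by positivity)
      hg.differentiableOn (fun w hw ↦ hgne w (mem_ball.1 hw).le) (fun w hw ↦ ?_) hz
    · refine h1.trans ?_
      rw [div_le_iff₀ hR0]
      have : 0 ≤ B * R ^ 2 := by positivity
      nlinarith
    · refine le_trans ?_ (hgmax w (by rw [mem_ball] at hw; linarith))
      have h7 : (1 : ℝ) ≤ 2 ^ (∑ ρ ∈ S, m ρ) := one_le_pow₀ (by norm_num)
      nlinarith [norm_nonneg (g w)]

/-- The logarithmic derivative of a product of linear factors and a zero-free factor. -/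
theorem logDeriv_eq_sum_add {f g : ℂ → ℂ} {S : Finset ℂ} {m : ℂ → ℕ} (hg : Differentiable ℂ g)
    (hfg : ∀ z, f z = (∏ ρ ∈ S, (z - ρ) ^ m ρ) * g z) {z : ℂ} (hz : f z ≠ 0)
    (hS : ∀ ρ ∈ S, f ρ = 0) :
    logDeriv f z = ∑ ρ ∈ S, (m ρ : ℂ) / (z - ρ) + logDeriv g z := by
  have hsub : ∀ ρ ∈ S, z - ρ ≠ 0 := fun ρ hρ h ↦ hz (by rw [sub_eq_zero.1 h, hS ρ hρ])
  rw [show f = fun z ↦ (∏ ρ ∈ S, (z - ρ) ^ m ρ) * g z from funext hfg, logDeriv_mul,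
    logDeriv_prod]
  · congr 1
    refine Finset.sum_congr rfl fun ρ hρ ↦ ?_
    rw [logDeriv_fun_pow (by fun_prop)]
    simp [logDeriv_apply, div_eq_mul_inv]
  · exact fun ρ hρ ↦ pow_ne_zero _ (hsub ρ hρ)
  · fun_prop
  · exact Finset.prod_ne_zero_iff.2 fun ρ hρ ↦ pow_ne_zero _ (hsub ρ hρ)
  · intro h
    exact hz (by rw [hfg, h, mul_zero])
  · fun_prop
  · exact hg z

end EntireFunction

/-! ### Contour integrals over rectangles -/

namespace EntireFunction

open Complex Set Filter Topology Metric MeasureTheory intervalIntegral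
open scoped Interval

/-- The counterclockwise integral of `F` over the boundary of the rectangle
`[a, b] × [-T, T]`. -/
noncomputable def rectIntegral (a b T : ℝ) (F : ℂ → ℂ) : ℂ :=
  (∫ x : ℝ in a..b, F (x + (-T : ℝ) * I)) - (∫ x : ℝ in a..b, F (x + (T : ℝ) * I)) +
    I * (∫ y : ℝ in (-T)..T, F (b + y * I)) - I * ∫ y : ℝ in (-T)..T, F (a + y * I)

/-- The boundary of the rectangle `[a, b] × [-T, T]`. -/
def rectBoundary (a b T : ℝ) : Set ℂ :=
  {z | z.re ∈ [[a, b]] ∧ (z.im = -T ∨ z.im = T)} ∪ {z | z.im ∈ [[-T, T]] ∧ (z.re = a ∨ z.re = b)}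

variable {a b T : ℝ} {F G : ℂ → ℂ}

theorem rectBoundary_subset : rectBoundary a b T ⊆ [[a, b]] ×ℂ [[-T, T]] := by
  rintro z (⟨h1, h2⟩ | ⟨h1, h2⟩)
  · refine ⟨h1, ?_⟩
    rcases h2 with h | h <;> simp [h]
  · refine ⟨?_, h1⟩
    rcases h2 with h | h <;> simp [h]

theorem intervalIntegrable_horizontal (hF : ContinuousOn F (rectBoundary a b T)) {t : ℝ}
    (ht : t = -T ∨ t = T) : IntervalIntegrable (fun x : ℝ ↦ F (x + t * I)) volume a b := by
  refine ContinuousOn.intervalIntegrable (hF.comp (by fun_prop) fun x hx ↦ Or.inl ?_)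
  simpa using ⟨hx, ht⟩

theorem intervalIntegrable_vertical (hF : ContinuousOn F (rectBoundary a b T)) {t : ℝ}
    (ht : t = a ∨ t = b) : IntervalIntegrable (fun y : ℝ ↦ F (t + y * I)) volume (-T) T := by
  refine ContinuousOn.intervalIntegrable (hF.comp (by fun_prop) fun x hx ↦ Or.inr ?_)
  simpa using ⟨hx, ht⟩

theorem rectIntegral_add (hF : ContinuousOn F (rectBoundary a b T))
    (hG : ContinuousOn G (rectBoundary a b T)) :
    rectIntegral a b T (fun z ↦ F z + G z) = rectIntegral a b T F + rectIntegral a b T G := by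
  simp only [rectIntegral]
  rw [integral_add (intervalIntegrable_horizontal hF (.inl rfl))
      (intervalIntegrable_horizontal hG (.inl rfl)),
    integral_add (intervalIntegrable_horizontal hF (.inr rfl))
      (intervalIntegrable_horizontal hG (.inr rfl)),
    integral_add (intervalIntegrable_vertical hF (.inl rfl))
      (intervalIntegrable_vertical hG (.inl rfl)),
    integral_add (intervalIntegrable_vertical hF (.inr rfl))
      (intervalIntegrable_vertical hG (.inr rfl))]
  ring

theorem rectIntegral_const_mul (k : ℂ) :
    rectIntegral a b T (fun z ↦ k * F z) = k * rectIntegral a b T F := by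
  simp only [rectIntegral, intervalIntegral.integral_const_mul]
  ring

theorem rectIntegral_sum {ι : Type*} (S : Finset ι) {F : ι → ℂ → ℂ}
    (hF : ∀ i ∈ S, ContinuousOn (F i) (rectBoundary a b T)) :
    rectIntegral a b T (fun z ↦ ∑ i ∈ S, F i z) = ∑ i ∈ S, rectIntegral a b T (F i) := by
  classical
  induction S using Finset.induction_on with
  | empty => simp [rectIntegral]
  | insert i S hi ih =>
    simp only [Finset.sum_insert hi]
    rw [rectIntegral_add (hF i (by simp)) (continuousOn_finsetSum _ fun j hj ↦ hF j (by simp [hj])),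
      ih fun j hj ↦ hF j (by simp [hj])]

theorem rectIntegral_congr (h : EqOn F G (rectBoundary a b T)) :
    rectIntegral a b T F = rectIntegral a b T G := by
  simp only [rectIntegral]
  have h1 : ∀ t : ℝ, (t = -T ∨ t = T) →
      ∫ x : ℝ in a..b, F (x + t * I) = ∫ x : ℝ in a..b, G (x + t * I) := fun t ht ↦
    integral_congr fun x hx ↦ h (Or.inl (by simpa using ⟨hx, ht⟩))
  have h2 : ∀ t : ℝ, (t = a ∨ t = b) →
      ∫ y : ℝ in (-T)..T, F (t + y * I) = ∫ y : ℝ in (-T)..T, G (t + y * I) := fun t ht ↦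
    integral_congr fun x hx ↦ h (Or.inr (by simpa using ⟨hx, ht⟩))
  rw [h1 _ (.inl rfl), h1 _ (.inr rfl), h2 _ (.inl rfl), h2 _ (.inr rfl)]

theorem rectIntegral_eq_zero (hF : DifferentiableOn ℂ F ([[a, b]] ×ℂ [[-T, T]])) :
    rectIntegral a b T F = 0 := by
  have := integral_boundary_rect_eq_zero_of_differentiableOn F (a + (-T : ℝ) * I) (b + T * I)
    (by simpa using hF)
  simpa [rectIntegral] using this

theorem hasDerivAt_log_line {k w : ℂ} {x : ℝ} (h : k * x + w ∈ slitPlane) :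
    HasDerivAt (fun x : ℝ ↦ Complex.log (k * x + w)) (k / (k * x + w)) x := by
  have h1 : HasDerivAt (fun x : ℝ ↦ k * (x : ℂ) + w) k x := by
    simpa using ((hasDerivAt_id x).ofReal_comp.const_mul k).add_const w
  exact h1.clog_real h

theorem integral_div_line {k w : ℂ} {x₀ x₁ : ℝ} (h : ∀ x ∈ [[x₀, x₁]], k * x + w ∈ slitPlane) :
    ∫ x in x₀..x₁, k / (k * (x : ℂ) + w) = log (k * x₁ + w) - log (k * x₀ + w) := by
  have hd := fun x hx ↦ hasDerivAt_log_line (h x hx)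
  refine integral_eq_sub_of_hasDerivAt (f := fun x : ℝ ↦ log (k * x + w)) hd ?_
  refine ContinuousOn.intervalIntegrable ?_
  refine continuousOn_const.div (by fun_prop) fun x hx ↦ slitPlane_ne_zero (h x hx)

/-- The integral of `1 / (z - ρ)` over the boundary of a rectangle containing `ρ`. -/
theorem rectIntegral_inv_sub {ρ : ℂ} (ha : a < ρ.re) (hb : ρ.re < b) (h1 : -T < ρ.im)
    (h2 : ρ.im < T) : rectIntegral a b T (fun z ↦ (z - ρ)⁻¹) = 2 * Real.pi * I := by
  have e1 : ∫ x : ℝ in a..b, ((x : ℂ) + (-T : ℝ) * I - ρ)⁻¹ =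
      log (b - T * I - ρ) - log (a - T * I - ρ) := by
    have := integral_div_line (k := 1) (w := -T * I - ρ) (x₀ := a) (x₁ := b) fun x _ ↦
      Or.inr (by simp; linarith)
    convert this using 2
    · ext x
      rw [one_div]
      congr 1
      push_cast
      ring
    · congr 1; ring
    · congr 1; ring
  have e2 : ∫ x : ℝ in a..b, ((x : ℂ) + (T : ℝ) * I - ρ)⁻¹ =
      log (b + T * I - ρ) - log (a + T * I - ρ) := by
    have := integral_div_line (k := 1) (w := T * I - ρ) (x₀ := a) (x₁ := b) fun x _ ↦
      Or.inr (by simp; linarith)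
    convert this using 2
    · ext x
      rw [one_div]
      congr 1
      ring
    · congr 1; ring
    · congr 1; ring
  have e3 : I * ∫ y : ℝ in (-T)..T, ((b : ℂ) + y * I - ρ)⁻¹ =
      log (b + T * I - ρ) - log (b - T * I - ρ) := by
    have := integral_div_line (k := I) (w := b - ρ) (x₀ := -T) (x₁ := T) fun x _ ↦
      Or.inl (by simp; linarith)
    have hfun : (fun y : ℝ ↦ I * ((b : ℂ) + y * I - ρ)⁻¹) = fun y : ℝ ↦ I / (I * y + (b - ρ)) := by
      ext y
      rw [← div_eq_mul_inv]
      congr 1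
      ring
    rw [← intervalIntegral.integral_const_mul, hfun, this]
    congr 2
    · ring
    · push_cast; ring
  -- The left side crosses the cut of the principal logarithm, so log(-(z - ρ)) is used instead.
  -- Returning to log(z - ρ) at the two corners costs -πi and +πi, and these produce the 2πi.
  have e4 : I * ∫ y : ℝ in (-T)..T, ((a : ℂ) + y * I - ρ)⁻¹ =
      log (-(a + T * I - ρ)) - log (-(a - T * I - ρ)) := by
    have := integral_div_line (k := -I) (w := ρ - a) (x₀ := -T) (x₁ := T) fun x _ ↦
      Or.inl (by simp; linarith)
    have hfun : (fun y : ℝ ↦ I * ((a : ℂ) + y * I - ρ)⁻¹) =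
        fun y : ℝ ↦ -I / (-I * y + (ρ - a)) := by
      ext y
      rw [← div_eq_mul_inv, ← neg_div_neg_eq]
      congr 1
      ring
    rw [← intervalIntegral.integral_const_mul, hfun, this]
    congr 2
    · ring
    · push_cast; ring
  have e5 : log (-(a + T * I - ρ)) = log (a + T * I - ρ) - Real.pi * I := by
    have him : 0 < (a + T * I - ρ : ℂ).im := by simp; linarith
    rw [log, log, arg_neg_eq_arg_sub_pi_of_im_pos him, norm_neg]
    push_cast
    ring
  have e6 : log (-(a - T * I - ρ)) = log (a - T * I - ρ) + Real.pi * I := by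
    have him : (a - T * I - ρ : ℂ).im < 0 := by simp; linarith
    rw [log, log, arg_neg_eq_arg_add_pi_of_im_neg him, norm_neg]
    push_cast
    ring
  simp only [rectIntegral]
  rw [e1, e2, e3, e4, e5, e6]
  ring

/-- Cauchy's integral formula for a rectangle. -/
theorem rectIntegral_div_sub {h : ℂ → ℂ} (hh : Differentiable ℂ h) {ρ : ℂ} (ha : a < ρ.re)
    (hb : ρ.re < b) (h1 : -T < ρ.im) (h2 : ρ.im < T) :
    rectIntegral a b T (fun z ↦ h z / (z - ρ)) = 2 * Real.pi * I * h ρ := by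
  have hne : ∀ z ∈ rectBoundary a b T, z - ρ ≠ 0 := by
    rintro z hz h0
    obtain rfl := sub_eq_zero.1 h0
    rcases hz with ⟨_, h3 | h3⟩ | ⟨_, h3 | h3⟩ <;> linarith
  -- The difference quotient is entire, so only the constant h ρ over z - ρ contributes.
  have hds : Differentiable ℂ (dslope h ρ) := by
    rw [← differentiableOn_univ, differentiableOn_dslope univ_mem]
    exact hh.differentiableOn
  have hinv : ContinuousOn (fun z ↦ (z - ρ)⁻¹) (rectBoundary a b T) :=
    ContinuousOn.inv₀ (by fun_prop) hne
  have hmul : ContinuousOn (fun z ↦ h ρ * (z - ρ)⁻¹) (rectBoundary a b T) :=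
    continuousOn_const.mul hinv
  rw [rectIntegral_congr (G := fun z ↦ dslope h ρ z + h ρ * (z - ρ)⁻¹), rectIntegral_add
    hds.continuous.continuousOn hmul, rectIntegral_const_mul,
    rectIntegral_eq_zero hds.differentiableOn, rectIntegral_inv_sub ha hb h1 h2]
  · ring
  · intro z hz
    have := hne z hz
    simp only [dslope_of_ne h (sub_ne_zero.1 this), slope_def_field]
    field_simp
    ring

theorem rectIntegral_div_sub_eq_zero {h : ℂ → ℂ} (hh : Differentiable ℂ h) {ρ : ℂ}
    (hT : 0 ≤ T) (h1 : T < |ρ.im|) : rectIntegral a b T (fun z ↦ h z / (z - ρ)) = 0 := by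
  refine rectIntegral_eq_zero (hh.differentiableOn.div (by fun_prop) fun z hz h0 ↦ ?_)
  obtain rfl := sub_eq_zero.1 h0
  have h2 : z.im ∈ [[-T, T]] := hz.2
  rw [uIcc_of_le (by linarith)] at h2
  exact absurd (abs_le.2 h2) (not_le.2 h1)

end EntireFunction

/-! ### Zero counts, good heights and the argument principle -/

namespace EntireFunction

open Complex Set Filter Topology Metric MeasureTheory intervalIntegral
open scoped Interval

/-- Avoiding finitely many points of an interval of length one. -/
theorem exists_mem_Icc_forall_le_abs_sub (E : Finset ℝ) (x : ℝ) :
    ∃ T ∈ Icc x (x + 1), ∀ e ∈ E, 1 / (4 * ((E.card : ℝ) + 1)) ≤ |T - e| := by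
  by_contra! hcon
  set δ : ℝ := 1 / (4 * ((E.card : ℝ) + 1)) with hδ
  -- Otherwise balls of radius δ around the points cover an interval of length one, while their
  -- total length is below 1/2.
  have hsub : Icc x (x + 1) ⊆ ⋃ e ∈ E, ball e δ := fun T hT ↦ by
    obtain ⟨e, he, hlt⟩ := hcon T hT
    exact mem_biUnion he (by rwa [mem_ball, Real.dist_eq])
  have h1 : volume (Icc x (x + 1)) ≤ ∑ e ∈ E, volume (ball e δ) :=
    (measure_mono hsub).trans (measure_biUnion_finset_le _ _)
  simp only [Real.volume_Icc, Real.volume_ball, Finset.sum_const, add_sub_cancel_left,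
    nsmul_eq_mul] at h1
  have h2 : (E.card : ENNReal) * ENNReal.ofReal (2 * δ) = ENNReal.ofReal (E.card * (2 * δ)) := by
    rw [ENNReal.ofReal_mul (p := (E.card : ℝ)) (by positivity), ENNReal.ofReal_natCast]
  rw [h2, ENNReal.ofReal_le_ofReal_iff (by positivity), hδ] at h1
  have h3 : (0 : ℝ) ≤ E.card := by positivity
  have h4 : (E.card : ℝ) * (2 * (1 / (4 * ((E.card : ℝ) + 1)))) < 1 := by
    rw [show (E.card : ℝ) * (2 * (1 / (4 * ((E.card : ℝ) + 1)))) =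
      E.card / (2 * (E.card + 1)) by field_simp; ring, div_lt_one (by positivity)]
    linarith
  linarith

theorem one_le_analyticOrderNatAt {f : ℂ → ℂ} (hf : Differentiable ℂ f) {c : ℂ} (hc : f c ≠ 0)
    {ρ : ℂ} (hρ : f ρ = 0) : 1 ≤ analyticOrderNatAt f ρ := by
  have h1 : analyticOrderAt f ρ ≠ 0 := (hf.analyticAt ρ).analyticOrderAt_ne_zero.2 hρ
  rw [Nat.one_le_iff_ne_zero, analyticOrderNatAt]
  exact fun h ↦ h1 ((ENat.toNat_eq_zero.1 h).resolve_right (analyticOrderAt_ne_top hf hc ρ))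

/-- The bound has the form R/2 for R = 2(2 + ‖c‖)(1 + x): for this R, strip points of height at most
x fall in the half disc where `exists_factorization` controls the logarithmic derivative. -/
theorem dist_le_of_strip {c z : ℂ} {x : ℝ} (h1 : -(1 / 2) ≤ z.re) (h2 : z.re ≤ 3 / 2)
    (h3 : |z.im| ≤ x) : dist z c ≤ 2 * (2 + ‖c‖) * (1 + x) / 2 := by
  have h4 : ‖z‖ ≤ 3 / 2 + x := (norm_le_abs_re_add_abs_im z).trans
    (add_le_add (abs_le.2 ⟨by linarith, h2⟩) h3)
  have h5 := norm_sub_le z c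
  rw [dist_eq_norm]
  nlinarith [norm_nonneg c, abs_nonneg z.im]

section

variable {f : ℂ → ℂ} (hf : Differentiable ℂ f) {c : ℂ} (hc : f c ≠ 0)
    {A : ℝ} (hA : ∀ z, ‖f z‖ ≤ Real.exp (A * (1 + ‖z‖) ^ 2)) (hline : ∀ z, f z = 0 → z.re = 1 / 2)

include hf hc hA in
theorem exists_sum_order_le : ∃ K : ℝ, 0 < K ∧ ∀ (x : ℝ) (S : Finset ℂ),
    (∀ ρ ∈ S, f ρ = 0 ∧ ρ.re = 1 / 2 ∧ |ρ.im| ≤ x) →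
      ∑ ρ ∈ S, (analyticOrderNatAt f ρ : ℝ) ≤ K * (1 + x) ^ 2 := by
  obtain ⟨K, hK, hfact⟩ := exists_factorization hf hc hA
  refine ⟨K * (2 * (2 + ‖c‖)) ^ 2, by positivity, fun x S hS ↦ ?_⟩
  rcases S.eq_empty_or_nonempty with rfl | ⟨ρ₀, hρ₀⟩
  · simp; positivity
  have hx : 0 ≤ x := (abs_nonneg _).trans (hS ρ₀ hρ₀).2.2
  obtain ⟨S', g, hS', hsum, -⟩ := hfact (2 * (2 + ‖c‖) * (1 + x))
    (by nlinarith [norm_nonneg c, mul_nonneg (norm_nonneg c) hx])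
  rw [mul_assoc, ← mul_pow]
  refine le_trans (Finset.sum_le_sum_of_subset_of_nonneg (fun ρ hρ ↦ ?_) fun _ _ _ ↦ by positivity)
    hsum
  obtain ⟨h0, h1, h2⟩ := hS ρ hρ
  refine (hS' ρ).2 ⟨h0, (dist_le_of_strip (by rw [h1]; norm_num) (by rw [h1]; norm_num) h2).trans ?_⟩
  have : 0 ≤ 2 * (2 + ‖c‖) * (1 + x) := by positivity
  linarith

-- A point with real part 3/2 is at distance at least 1 from every zero, so the sum of m(ρ)/(z - ρ)
-- is at most the number of zeros counted.
include hf hc hA hline in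
theorem exists_norm_logDeriv_le_right : ∃ K : ℝ, 0 < K ∧ ∀ t : ℝ,
    ‖logDeriv f ((3 / 2 : ℝ) + t * I)‖ ≤ K * (1 + |t|) ^ 2 := by
  obtain ⟨K, hK, hfact⟩ := exists_factorization hf hc hA
  refine ⟨2 * K * (2 * (2 + ‖c‖)) ^ 2, by positivity, fun t ↦ ?_⟩
  set z : ℂ := (3 / 2 : ℝ) + t * I with hz
  have hre : z.re = 3 / 2 := by simp [hz]
  have him : z.im = t := by simp [hz]
  obtain ⟨S, g, hS, hsum, hg, -, hfg, hlog⟩ := hfact (2 * (2 + ‖c‖) * (1 + |t|))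
    (by nlinarith [norm_nonneg c, mul_nonneg (norm_nonneg c) (abs_nonneg t), abs_nonneg t])
  have hfz : f z ≠ 0 := fun h ↦ by have := hline z h; norm_num [hre] at this
  rw [logDeriv_eq_sum_add hg hfg hfz fun ρ hρ ↦ ((hS ρ).1 hρ).1]
  have h1 := hlog z (dist_le_of_strip (by rw [hre]; norm_num) hre.le (by rw [him]))
  have h2 : ‖∑ ρ ∈ S, (analyticOrderNatAt f ρ : ℂ) / (z - ρ)‖ ≤
      ∑ ρ ∈ S, (analyticOrderNatAt f ρ : ℝ) := by
    refine (norm_sum_le _ _).trans (Finset.sum_le_sum fun ρ hρ ↦ ?_)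
    rw [norm_div, Complex.norm_natCast]
    refine div_le_self (by positivity) ?_
    have h3 := abs_re_le_norm (z - ρ)
    rw [sub_re, hre, hline ρ ((hS ρ).1 hρ).1] at h3
    norm_num at h3
    exact h3
  refine (norm_add_le _ _).trans ((add_le_add (h2.trans hsum) h1).trans (le_of_eq ?_))
  ring

include hf hc hA in
/-- Good heights for horizontal contours. -/
theorem exists_good_height : ∃ K : ℝ, 0 < K ∧ ∀ n : ℕ, ∃ T : ℝ, (n : ℝ) ≤ T ∧ T ≤ n + 1 ∧
    ∀ z : ℂ, -(1 / 2) ≤ z.re → z.re ≤ 3 / 2 → |z.im| = T →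
      f z ≠ 0 ∧ ‖logDeriv f z‖ ≤ K * (1 + n) ^ 4 := by
  obtain ⟨K, hK, hfact⟩ := exists_factorization hf hc hA
  set D : ℝ := 2 * (2 + ‖c‖) with hD
  have hD4 : 4 ≤ D := by rw [hD]; linarith [norm_nonneg c]
  refine ⟨16 * K * D ^ 2 * (4 * (4 * K * D ^ 2 + 1) + 1), by positivity, fun n ↦ ?_⟩
  obtain ⟨S, g, hS, hsum, hg, -, hfg, hlog⟩ := hfact (D * (1 + (n + 1)))
    (by nlinarith [n.cast_nonneg (α := ℝ)])
  set m : ℂ → ℕ := analyticOrderNatAt f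
  -- There are at most N = O((1 + n)^2) ordinates, so T keeps a distance 1/(4(N + 1)) from them and
  -- the sum over zeros is O(N^2), whence the exponent 4. Using |Im ρ| makes T good for the top and
  -- bottom sides at once.
  obtain ⟨T, ⟨hT1, hT2⟩, hT⟩ := exists_mem_Icc_forall_le_abs_sub (S.image fun ρ ↦ |ρ.im|) n
  refine ⟨T, hT1, hT2, fun z hz1 hz2 hz3 ↦ ?_⟩
  have hdist : dist z c ≤ D * (1 + (n + 1)) / 2 := dist_le_of_strip hz1 hz2 (hz3.trans_le hT2)
  set N : ℝ := K * (D * (1 + (n + 1))) ^ 2 with hN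
  have hN0 : 0 ≤ N := by positivity
  have hcard : ((S.image fun ρ ↦ |ρ.im|).card : ℝ) ≤ N := by
    refine le_trans ?_ hsum
    have h1 : ((S.image fun ρ ↦ |ρ.im|).card : ℝ) ≤ S.card := by exact_mod_cast Finset.card_image_le
    refine h1.trans ?_
    rw [Finset.cast_card]
    refine Finset.sum_le_sum fun ρ hρ ↦ ?_
    exact_mod_cast one_le_analyticOrderNatAt hf hc ((hS ρ).1 hρ).1
  have hsep : ∀ ρ ∈ S, 1 / (4 * (N + 1)) ≤ ‖z - ρ‖ := by
    intro ρ hρ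
    have h1 := hT _ (Finset.mem_image_of_mem _ hρ)
    refine le_trans (le_trans ?_ h1) ?_
    · gcongr
    · rw [← hz3]
      exact (abs_abs_sub_abs_le _ _).trans (by simpa using abs_im_le_norm (z - ρ))
  have hfz : f z ≠ 0 := by
    intro h
    have h1 := hsep z ((hS z).2 ⟨h, hdist.trans (half_le_self (by positivity))⟩)
    rw [sub_self, norm_zero] at h1
    have : 0 < 1 / (4 * (N + 1)) := by positivity
    linarith
  refine ⟨hfz, ?_⟩
  rw [logDeriv_eq_sum_add hg hfg hfz fun ρ hρ ↦ ((hS ρ).1 hρ).1]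
  have h1 := hlog z hdist
  have h2 : ‖∑ ρ ∈ S, (m ρ : ℂ) / (z - ρ)‖ ≤ (∑ ρ ∈ S, (m ρ : ℝ)) * (4 * (N + 1)) := by
    rw [Finset.sum_mul]
    refine (norm_sum_le _ _).trans (Finset.sum_le_sum fun ρ hρ ↦ ?_)
    rw [norm_div, Complex.norm_natCast, div_eq_mul_inv]
    gcongr
    rw [← one_div]
    have h3 := hsep ρ hρ
    have h4 : 0 < 1 / (4 * (N + 1)) := by positivity
    rw [div_le_iff₀ (h4.trans_le h3)]
    rw [div_le_iff₀ (by positivity)] at h3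
    linarith
  have hn : (0 : ℝ) ≤ n := n.cast_nonneg
  have hNle : N ≤ 4 * K * D ^ 2 * (1 + n) ^ 2 := by
    rw [hN, mul_pow, ← mul_assoc]
    have : (1 + ((n : ℝ) + 1)) ^ 2 ≤ 4 * (1 + n) ^ 2 := by nlinarith
    nlinarith [mul_pos hK (pow_pos (by linarith : 0 < D) 2)]
  have hNle' : 4 * (N + 1) + 1 ≤ (4 * (4 * K * D ^ 2 + 1) + 1) * (1 + n) ^ 2 := by
    have : 1 ≤ (1 + (n : ℝ)) ^ 2 := one_le_pow₀ (by linarith)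
    nlinarith
  calc ‖∑ ρ ∈ S, (m ρ : ℂ) / (z - ρ) + logDeriv g z‖
      ≤ N * (4 * (N + 1)) + N := (norm_add_le _ _).trans (add_le_add
        (h2.trans (by gcongr)) h1)
    _ = N * (4 * (N + 1) + 1) := by ring
    _ ≤ (4 * K * D ^ 2 * (1 + n) ^ 2) * ((4 * (4 * K * D ^ 2 + 1) + 1) * (1 + n) ^ 2) := by gcongr
    _ = 4 * K * D ^ 2 * (4 * (4 * K * D ^ 2 + 1) + 1) * (1 + n) ^ 4 := by ring
    _ ≤ _ := by
      have : 0 ≤ K * D ^ 2 * (4 * (4 * K * D ^ 2 + 1) + 1) * (1 + (n : ℝ)) ^ 4 := by positivity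
      nlinarith

include hf hc hA hline in
/-- The argument principle on the rectangle `[-1/2, 3/2] × [-T, T]`. -/
theorem rectIntegral_mul_logDeriv {h : ℂ → ℂ} (hh : Differentiable ℂ h) {T : ℝ} (hT : 0 ≤ T)
    (hTz : ∀ z : ℂ, -(1 / 2) ≤ z.re → z.re ≤ 3 / 2 → |z.im| = T → f z ≠ 0) (Z : Finset ℝ)
    (hZ : ∀ γ : ℝ, γ ∈ Z ↔ f (1 / 2 + γ * I) = 0 ∧ |γ| < T) :
    rectIntegral (-(1 / 2)) (3 / 2) T (fun z ↦ h z * logDeriv f z) =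
      2 * Real.pi * I * ∑ γ ∈ Z, (analyticOrderNatAt f (1 / 2 + γ * I) : ℂ) *
        h (1 / 2 + γ * I) := by
  obtain ⟨K, hK, hfact⟩ := exists_factorization hf hc hA
  obtain ⟨S, g, hS, -, hg, hgne, hfg, -⟩ := hfact (2 * (2 + ‖c‖) * (1 + T))
    (by nlinarith [norm_nonneg c, mul_nonneg (norm_nonneg c) hT])
  have hR0 : 0 ≤ 2 * (2 + ‖c‖) * (1 + T) := by positivity
  set m : ℂ → ℕ := analyticOrderNatAt f
  have hrect : ∀ z ∈ [[-(1 / 2 : ℝ), 3 / 2]] ×ℂ [[-T, T]],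
      dist z c ≤ 2 * (2 + ‖c‖) * (1 + T) := by
    rintro z ⟨h1, h2⟩
    simp only [mem_preimage] at h1 h2
    rw [uIcc_of_le (by norm_num)] at h1
    rw [uIcc_of_le (by linarith)] at h2
    exact (dist_le_of_strip h1.1 h1.2 (abs_le.2 h2)).trans (half_le_self hR0)
  have hbd : ∀ z ∈ rectBoundary (-(1 / 2)) (3 / 2) T, f z ≠ 0 := by
    rintro z (⟨h1, h2⟩ | ⟨h1, h2⟩) h0
    · rw [uIcc_of_le (by norm_num)] at h1
      refine hTz z h1.1 h1.2 ?_ h0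
      rcases h2 with h2 | h2 <;> simp [h2, abs_of_nonneg hT]
    · have := hline z h0
      rcases h2 with h2 | h2 <;> norm_num [h2] at this
  have hglog : DifferentiableOn ℂ (fun z ↦ h z * logDeriv g z)
      ([[-(1 / 2 : ℝ), 3 / 2]] ×ℂ [[-T, T]]) := by
    refine hh.differentiableOn.mul (DifferentiableOn.div ?_ hg.differentiableOn
      fun z hz ↦ hgne z (hrect z hz))
    exact fun z _ ↦ (hg.analyticAt z).deriv.differentiableAt.differentiableWithinAt
  have hne : ∀ ρ ∈ S, ∀ z ∈ rectBoundary (-(1 / 2)) (3 / 2) T, z - ρ ≠ 0 := by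
    intro ρ hρ z hz h0
    exact hbd z hz (by rw [sub_eq_zero.1 h0, ((hS ρ).1 hρ).1])
  have hcont : ∀ ρ ∈ S, ContinuousOn (fun z ↦ h z / (z - ρ)) (rectBoundary (-(1 / 2)) (3 / 2) T) :=
    fun ρ hρ ↦ hh.continuous.continuousOn.div (by fun_prop) (hne ρ hρ)
  have hcont' : ∀ ρ ∈ S, ContinuousOn (fun z ↦ (m ρ : ℂ) * (h z / (z - ρ)))
      (rectBoundary (-(1 / 2)) (3 / 2) T) := fun ρ hρ ↦ continuousOn_const.mul (hcont ρ hρ)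
  rw [rectIntegral_congr
    (G := fun z ↦ (∑ ρ ∈ S, (m ρ : ℂ) * (h z / (z - ρ))) + h z * logDeriv g z),
    rectIntegral_add (continuousOn_finsetSum _ hcont')
      (hglog.continuousOn.mono rectBoundary_subset), rectIntegral_eq_zero hglog, add_zero,
    rectIntegral_sum S hcont']
  -- The disc contains more zeros than the rectangle. Those with |Im ρ| > T leave the integrand
  -- holomorphic there, and `hTz` excludes |Im ρ| = T.
  · have hterm : ∀ ρ ∈ S, rectIntegral (-(1 / 2)) (3 / 2) T
        (fun z ↦ (m ρ : ℂ) * (h z / (z - ρ))) =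
        if |ρ.im| < T then 2 * Real.pi * I * ((m ρ : ℂ) * h ρ) else 0 := by
      intro ρ hρ
      have h0 := ((hS ρ).1 hρ).1
      have hre := hline ρ h0
      rw [rectIntegral_const_mul]
      split_ifs with hlt
      · rw [rectIntegral_div_sub hh (by rw [hre]; norm_num) (by rw [hre]; norm_num)
          (abs_lt.1 hlt).1 (abs_lt.1 hlt).2]
        ring
      · have : T < |ρ.im| := lt_of_le_of_ne (not_lt.1 hlt) fun he ↦
          hTz ρ (by rw [hre]; norm_num) (by rw [hre]; norm_num) he.symm h0
        rw [rectIntegral_div_sub_eq_zero hh hT this, mul_zero]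
    rw [Finset.sum_congr rfl hterm, ← Finset.sum_filter, Finset.mul_sum]
    have hval : ∀ ρ : ℂ, f ρ = 0 → (1 / 2 + (ρ.im : ℂ) * I : ℂ) = ρ := fun ρ h0 ↦ by
      apply Complex.ext
      · simp [hline ρ h0]
      · simp
    refine Finset.sum_bij' (fun ρ _ ↦ ρ.im) (fun γ _ ↦ 1 / 2 + γ * I) ?_ ?_ ?_ ?_ ?_
    · intro ρ hρ
      obtain ⟨h1, h2⟩ := Finset.mem_filter.1 hρ
      have h0 := ((hS ρ).1 h1).1
      rw [hZ, hval ρ h0]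
      exact ⟨h0, h2⟩
    · intro γ hγ
      obtain ⟨h1, h2⟩ := (hZ γ).1 hγ
      refine Finset.mem_filter.2 ⟨(hS _).2 ⟨h1, ?_⟩, by simpa using h2⟩
      refine (dist_le_of_strip (x := T) ?_ ?_ ?_).trans (half_le_self hR0)
      · norm_num
      · norm_num
      · simpa using h2.le
    · intro ρ hρ
      exact hval ρ ((hS ρ).1 (Finset.mem_filter.1 hρ).1).1
    · intro γ _
      simp
    · intro ρ hρ
      rw [hval ρ ((hS ρ).1 (Finset.mem_filter.1 hρ).1).1]
  · intro z hz
    simp only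
    rw [logDeriv_eq_sum_add hg hfg (hbd z hz) fun ρ hρ ↦ ((hS ρ).1 hρ).1, mul_add, Finset.mul_sum]
    congr 1
    exact Finset.sum_congr rfl fun ρ _ ↦ by ring

end

end EntireFunction

/-! ### The explicit formula for a symmetric entire function -/

namespace EntireFunction

open Complex Set Filter Topology Metric MeasureTheory intervalIntegral
open scoped Interval

/-- Summability of a rapidly decreasing function against weights of quadratic growth. -/
theorem summable_of_quadratic_growth {ι : Type*} {w : ι → ℝ} {x : ι → ℝ} (hw : ∀ i, 0 ≤ w i)
    (hx : ∀ i, 0 ≤ x i) {K : ℝ}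
    (hK : ∀ (y : ℝ) (s : Finset ι), (∀ i ∈ s, x i ≤ y) → ∑ i ∈ s, w i ≤ K * (1 + y) ^ 2) :
    Summable fun i ↦ w i / (1 + x i) ^ 4 := by
  classical
  have hK0 : 0 ≤ K := by simpa using hK 0 ∅ (by simp)
  have hsum : Summable fun n : ℕ ↦ 4 * K * (1 / ((n : ℝ) + 1) ^ 2) := by
    refine Summable.mul_left _ ?_
    have := (summable_nat_add_iff 1).2 (Real.summable_one_div_nat_pow.2 one_lt_two)
    simpa using this
  refine summable_of_sum_le (c := ∑' n : ℕ, 4 * K * (1 / ((n : ℝ) + 1) ^ 2))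
    (fun i ↦ div_nonneg (hw i) (by have := hx i; positivity)) fun s ↦ ?_
  obtain ⟨N, hN⟩ : ∃ N : ℕ, ∀ i ∈ s, ⌊x i⌋₊ ∈ Finset.range N := by
    refine ⟨s.sup (fun i ↦ ⌊x i⌋₊) + 1, fun i hi ↦ ?_⟩
    rw [Finset.mem_range, Nat.lt_succ_iff]
    exact Finset.le_sup (f := fun i ↦ ⌊x i⌋₊) hi
  -- Group the indices by ⌊x⌋ = n: a block has weight at most K(n + 2)^2 ≤ 4K(n + 1)^2, and division
  -- by (n + 1)^4 leaves a convergent series.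
  rw [← Finset.sum_fiberwise_of_maps_to hN]
  refine le_trans (Finset.sum_le_sum fun n _ ↦ ?_)
    (hsum.sum_le_tsum (Finset.range N) fun n _ ↦ by positivity)
  have hn : (0 : ℝ) ≤ n := n.cast_nonneg
  have hmem : ∀ i ∈ s.filter (fun i ↦ ⌊x i⌋₊ = n), (n : ℝ) ≤ x i ∧ x i ≤ n + 1 := by
    intro i hi
    obtain ⟨-, h⟩ := Finset.mem_filter.1 hi
    refine ⟨by rw [← h]; exact Nat.floor_le (hx i), by rw [← h]; exact (Nat.lt_floor_add_one _).le⟩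
  calc ∑ i ∈ s.filter (fun i ↦ ⌊x i⌋₊ = n), w i / (1 + x i) ^ 4
      ≤ ∑ i ∈ s.filter (fun i ↦ ⌊x i⌋₊ = n), w i / (1 + n) ^ 4 := by
        refine Finset.sum_le_sum fun i hi ↦ ?_
        have := (hmem i hi).1
        have := hw i
        gcongr
    _ = (∑ i ∈ s.filter (fun i ↦ ⌊x i⌋₊ = n), w i) / (1 + n) ^ 4 := by rw [Finset.sum_div]
    _ ≤ K * (1 + (n + 1)) ^ 2 / (1 + n) ^ 4 := by
        gcongr
        exact hK _ _ fun i hi ↦ (hmem i hi).2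
    _ ≤ 4 * K * (1 / ((n : ℝ) + 1) ^ 2) := by
        rw [mul_one_div, div_le_div_iff₀ (by positivity) (by positivity)]
        have h1 : (1 + ((n : ℝ) + 1)) ^ 2 ≤ 4 * (n + 1) ^ 2 := by nlinarith
        calc K * (1 + ((n : ℝ) + 1)) ^ 2 * (n + 1) ^ 2
            ≤ K * (4 * (n + 1) ^ 2) * (n + 1) ^ 2 := by gcongr
          _ = _ := by ring

variable {f : ℂ → ℂ} (hf : Differentiable ℂ f) {c : ℂ} (hc : f c ≠ 0)
    {A : ℝ} (hA : ∀ z, ‖f z‖ ≤ Real.exp (A * (1 + ‖z‖) ^ 2)) (hline : ∀ z, f z = 0 → z.re = 1 / 2)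
    (hFE : ∀ z, f (1 - z) = f z) {h : ℂ → ℂ} (hh : Differentiable ℂ h)
    (hhFE : ∀ z, h (1 - z) = h z) {C : ℝ}
    (hdecay : ∀ z : ℂ, -(1 / 2) ≤ z.re → z.re ≤ 3 / 2 → ‖h z‖ ≤ C / (1 + |z.im|) ^ 6)

include hf hc hA hdecay in
theorem summable_order_mul : Summable fun γ : {γ : ℝ | f (1 / 2 + γ * I) = 0} ↦
    (analyticOrderNatAt f (1 / 2 + (γ : ℝ) * I) : ℂ) * h (1 / 2 + (γ : ℝ) * I) := by
  obtain ⟨K, hK, hsum⟩ := exists_sum_order_le hf hc hA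
  have hC : 0 ≤ C := by
    have := (norm_nonneg _).trans (hdecay 0 (by norm_num) (by norm_num))
    simpa using this
  have hinj : Function.Injective fun γ : {γ : ℝ | f (1 / 2 + γ * I) = 0} ↦
      (1 / 2 + ((γ : ℝ) : ℂ) * I : ℂ) := by
    intro γ γ' hγ
    have := congrArg Complex.im hγ
    exact Subtype.ext (by simpa using this)
  have key := summable_of_quadratic_growth (ι := {γ : ℝ | f (1 / 2 + γ * I) = 0})
    (w := fun γ ↦ (analyticOrderNatAt f (1 / 2 + (γ : ℝ) * I) : ℝ)) (x := fun γ ↦ |(γ : ℝ)|)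
    (fun _ ↦ by positivity) (fun _ ↦ abs_nonneg _) (K := K) (fun y s hs ↦ by
      have := hsum y (s.map ⟨_, hinj⟩) (fun ρ hρ ↦ by
        obtain ⟨γ, hγ, rfl⟩ := Finset.mem_map.1 hρ
        refine ⟨γ.2, by simp, by simpa using hs γ hγ⟩)
      rwa [Finset.sum_map] at this)
  refine Summable.of_norm_bounded (key.mul_left C) fun γ ↦ ?_
  rw [norm_mul, Complex.norm_natCast]
  have h1 := hdecay (1 / 2 + (γ : ℝ) * I) (by norm_num) (by norm_num)
  have h2 : (1 / 2 + ((γ : ℝ) : ℂ) * I).im = γ := by simp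
  rw [h2] at h1
  have h3 : C / (1 + |(γ : ℝ)|) ^ 6 ≤ C / (1 + |(γ : ℝ)|) ^ 4 := by
    gcongr
    · linarith [abs_nonneg (γ : ℝ)]
    · norm_num
  calc _ ≤ (analyticOrderNatAt f (1 / 2 + (γ : ℝ) * I) : ℝ) * (C / (1 + |(γ : ℝ)|) ^ 4) := by
        gcongr
        exact h1.trans h3
    _ = _ := by ring

include hf hc hA hline hh hdecay in
theorem integrable_mul_logDeriv :
    Integrable fun t : ℝ ↦ h ((3 / 2 : ℝ) + t * I) * logDeriv f ((3 / 2 : ℝ) + t * I) := by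
  obtain ⟨K, hK, hlog⟩ := exists_norm_logDeriv_le_right hf hc hA hline
  have hC : 0 ≤ C := by
    have := (norm_nonneg _).trans (hdecay 0 (by norm_num) (by norm_num))
    simpa using this
  have hcont : Continuous fun t : ℝ ↦
      h ((3 / 2 : ℝ) + t * I) * logDeriv f ((3 / 2 : ℝ) + t * I) := by
    have hderiv : Continuous (deriv f) := (hf.contDiff (n := 1)).continuous_deriv le_rfl
    refine (hh.continuous.comp (by fun_prop)).mul ?_
    refine Continuous.div (hderiv.comp (by fun_prop)) (hf.continuous.comp (by fun_prop)) ?_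
    intro t h0
    have := hline _ h0
    norm_num at this
  refine Integrable.mono' (integrable_inv_one_add_sq.const_mul (C * K))
    hcont.aestronglyMeasurable (ae_of_all _ fun t ↦ ?_)
  have h1 := hdecay ((3 / 2 : ℝ) + t * I) (by norm_num) (by norm_num)
  have h2 : (((3 / 2 : ℝ) : ℂ) + t * I).im = t := by simp
  rw [h2] at h1
  rw [norm_mul]
  calc _ ≤ C / (1 + |t|) ^ 6 * (K * (1 + |t|) ^ 2) := by
        gcongr
        exact hlog t
    _ = C * K * ((1 + |t|) ^ 4)⁻¹ := by
        have : (1 + |t|) ≠ 0 := by positivity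
        field_simp
    _ ≤ C * K * (1 + t ^ 2)⁻¹ := by
        gcongr
        have h3 := abs_nonneg t
        have h4 : 1 + |t| ^ 2 ≤ (1 + |t|) ^ 2 := by nlinarith
        rw [sq_abs] at h4
        refine h4.trans (pow_le_pow_right₀ (by linarith) (by norm_num))

include hf hFE in
theorem logDeriv_one_sub (z : ℂ) : logDeriv f (1 - z) = -logDeriv f z := by
  have h1 : HasDerivAt (fun w ↦ f (1 - w)) (-deriv f (1 - z)) z :=
    (hf (1 - z)).hasDerivAt.comp_const_sub 1 z
  have h2 : deriv f z = -deriv f (1 - z) := by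
    rw [← h1.deriv]
    congr 1
    ext w
    rw [hFE]
  rw [logDeriv_apply, logDeriv_apply, hFE, h2]
  ring

include hf hc hA hline hFE hh hhFE hdecay in
/-- The explicit formula for an entire function of order at most two that is symmetric about
`Re z = 1/2` and has all its zeros on this line. -/
theorem hasSum_zeros : HasSum (fun γ : {γ : ℝ | f (1 / 2 + γ * I) = 0} ↦
    (analyticOrderNatAt f (1 / 2 + (γ : ℝ) * I) : ℂ) * h (1 / 2 + (γ : ℝ) * I))
    (1 / Real.pi * ∫ t : ℝ, h ((3 / 2 : ℝ) + t * I) * logDeriv f ((3 / 2 : ℝ) + t * I)) := by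
  set F : ℂ → ℂ := fun z ↦ h z * logDeriv f z with hF
  have hsum := summable_order_mul hf hc hA hdecay
  have hint := integrable_mul_logDeriv hf hc hA hline hh hdecay
  have hC : 0 ≤ C := by
    have := (norm_nonneg _).trans (hdecay 0 (by norm_num) (by norm_num))
    simpa using this
  obtain ⟨K, hK, hgood⟩ := exists_good_height hf hc hA
  choose T hT1 hT2 hT using hgood
  have hTtop : Tendsto T atTop atTop := tendsto_atTop_mono hT1 tendsto_natCast_atTop_atTop
  have hFsymm : ∀ z, F (1 - z) = -F z := fun z ↦ by
    simp only [hF, hhFE, logDeriv_one_sub hf hFE, mul_neg]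
  -- the finite sets of zeros
  have hfin : ∀ n, {γ : {γ : ℝ | f (1 / 2 + γ * I) = 0} | |(γ : ℝ)| < T n}.Finite := by
    intro n
    refine Set.Finite.of_finite_image
      (f := fun γ : {γ : ℝ | f (1 / 2 + γ * I) = 0} ↦ (1 / 2 + ((γ : ℝ) : ℂ) * I : ℂ))
      ((finite_zeros_inter_closedBall hf hc 0 (1 / 2 + T n)).subset ?_) ?_
    · rintro _ ⟨γ, hγ, rfl⟩
      refine ⟨γ.2, ?_⟩
      rw [dist_zero_right]
      refine (norm_le_abs_re_add_abs_im _).trans (add_le_add ?_ ?_)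
      · simp [abs_of_pos]
      · simpa using le_of_lt hγ
    · intro γ _ γ' _ hγ
      have := congrArg Complex.im hγ
      exact Subtype.ext (by simpa using this)
  let Z : ℕ → Finset {γ : ℝ | f (1 / 2 + γ * I) = 0} := fun n ↦ (hfin n).toFinset
  have hZtop : Tendsto Z atTop atTop := by
    rw [Filter.tendsto_atTop]
    intro s
    have : ∀ᶠ n in atTop, ∀ γ ∈ s, |(γ : ℝ)| < T n :=
      (Finset.eventually_all s).2 fun γ _ ↦ hTtop.eventually_gt_atTop _
    filter_upwards [this] with n hn γ hγ
    simpa [Z] using hn γ hγ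
  have hres : ∀ n, rectIntegral (-(1 / 2)) (3 / 2) (T n) F = 2 * Real.pi * I * ∑ γ ∈ Z n,
      (analyticOrderNatAt f (1 / 2 + (γ : ℝ) * I) : ℂ) * h (1 / 2 + (γ : ℝ) * I) := by
    intro n
    have hT0 : 0 ≤ T n := n.cast_nonneg.trans (hT1 n)
    have hmem : ∀ γ : ℝ, γ ∈ (Z n).map (Function.Embedding.subtype _) ↔
        f (1 / 2 + γ * I) = 0 ∧ |γ| < T n := by
      intro γ
      rw [Finset.mem_map]
      constructor
      · rintro ⟨γ', h', rfl⟩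
        exact ⟨γ'.2, (hfin n).mem_toFinset.1 h'⟩
      · rintro ⟨h1, h2⟩
        exact ⟨⟨γ, h1⟩, (hfin n).mem_toFinset.2 h2, rfl⟩
    rw [rectIntegral_mul_logDeriv hf hc hA hline hh hT0 (fun z h1 h2 h3 ↦ (hT n z h1 h2 h3).1)
      ((Z n).map (Function.Embedding.subtype _)) hmem, Finset.sum_map]
    rfl
  -- horizontal sides
  have hhor : ∀ t : ℕ → ℝ, (∀ n, |t n| = T n) →
      Tendsto (fun n ↦ ∫ x : ℝ in (-(1 / 2))..(3 / 2), F (x + t n * I)) atTop (𝓝 0) := by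
    intro t ht
    have hlim : Tendsto (fun n : ℕ ↦ C * K * 2 * (1 / ((n : ℝ) + 1))) atTop (𝓝 0) := by
      simpa using tendsto_one_div_add_atTop_nhds_zero_nat.const_mul (C * K * 2)
    refine squeeze_zero_norm (fun n ↦ ?_) hlim
    have hn : (0 : ℝ) ≤ n := n.cast_nonneg
    have hb : ∀ x ∈ Ι (-(1 / 2) : ℝ) (3 / 2), ‖F (x + t n * I)‖ ≤ C * K * (1 / ((n : ℝ) + 1)) := by
      intro x hx
      rw [uIoc_of_le (by norm_num)] at hx
      have hre : ((x : ℂ) + t n * I).re = x := by simp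
      have him : ((x : ℂ) + t n * I).im = t n := by simp
      have h1 := hdecay (x + t n * I) (by rw [hre]; exact hx.1.le) (by rw [hre]; exact hx.2)
      have h2 := (hT n (x + t n * I) (by rw [hre]; exact hx.1.le) (by rw [hre]; exact hx.2)
        (by rw [him, ht])).2
      rw [him, ht] at h1
      rw [hF, norm_mul]
      -- Decay of order 6 beats the growth of order 4 of the logarithmic derivative at good heights.
      calc _ ≤ C / (1 + n) ^ 6 * (K * (1 + n) ^ 4) := by
            gcongr
            refine h1.trans ?_
            gcongr
            exact hT1 n
        _ = C * K * (1 / (n + 1) ^ 2) := by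
            field_simp
            ring
        _ ≤ C * K * (1 / ((n : ℝ) + 1)) := by
            gcongr
            nlinarith
    refine (norm_integral_le_of_norm_le_const hb).trans (le_of_eq ?_)
    norm_num [abs_of_pos]
    ring
  have hvert : Tendsto (fun n ↦ ∫ y : ℝ in (-T n)..(T n), F ((3 / 2 : ℝ) + y * I)) atTop
      (𝓝 (∫ t : ℝ, F ((3 / 2 : ℝ) + t * I))) :=
    intervalIntegral_tendsto_integral hint (tendsto_neg_atTop_atBot.comp hTtop) hTtop
  -- Reflection z ↦ 1 - z exchanges the vertical sides and changes the sign of F; with opposite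
  -- orientations the two sides contribute equally.
  have hleft : ∀ n, ∫ y : ℝ in (-T n)..(T n), F ((-(1 / 2) : ℝ) + y * I) =
      -∫ y : ℝ in (-T n)..(T n), F ((3 / 2 : ℝ) + y * I) := by
    intro n
    have h1 : ∀ y : ℝ, F ((-(1 / 2) : ℝ) + y * I) = -F ((3 / 2 : ℝ) + (-y : ℝ) * I) := by
      intro y
      rw [← hFsymm]
      congr 1
      push_cast
      ring
    simp only [h1]
    rw [intervalIntegral.integral_neg,
      intervalIntegral.integral_comp_neg (fun y : ℝ ↦ F ((3 / 2 : ℝ) + y * I)), neg_neg]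
  have hlim : Tendsto (fun n ↦ rectIntegral (-(1 / 2)) (3 / 2) (T n) F) atTop
      (𝓝 (2 * I * ∫ t : ℝ, F ((3 / 2 : ℝ) + t * I))) := by
    have h1 := ((hhor (fun n ↦ -T n) fun n ↦ by
      rw [abs_neg, abs_of_nonneg (n.cast_nonneg.trans (hT1 n))]).sub
      (hhor T fun n ↦ abs_of_nonneg (n.cast_nonneg.trans (hT1 n)))).add (hvert.const_mul (2 * I))
    rw [sub_zero, zero_add] at h1
    refine h1.congr fun n ↦ ?_
    rw [rectIntegral, hleft n]
    ring
  have hlim' := hlim.const_mul (1 / (2 * Real.pi * I) : ℂ)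
  have hpi : (Real.pi : ℂ) ≠ 0 := ofReal_ne_zero.2 Real.pi_ne_zero
  -- Absolute convergence is already known, so the sum may be computed along the cofinal sequence `Z
  -- n`.
  have hs := (hsum.hasSum.comp hZtop : Tendsto _ atTop _)
  have heq := tendsto_nhds_unique hs (hlim'.congr fun n ↦ by
    rw [hres n]
    simp only [Function.comp]
    field_simp)
  convert hsum.hasSum using 1
  rw [heq, ← mul_assoc]
  congr 1
  field_simp

end EntireFunction

/-! ### Fourier–Laplace transforms of compactly supported functions -/

namespace PaleyWiener

open Complex Set Filter Topology MeasureTheory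

/-- The Fourier–Laplace transform `z ↦ ∫ ψ(ω) exp (2 π i ω z) dω`. -/
noncomputable def laplace (ψ : ℝ → ℂ) (z : ℂ) : ℂ :=
  ∫ ω : ℝ, ψ ω * exp (2 * (Real.pi : ℂ) * I * (ω : ℂ) * z)

variable {ψ : ℝ → ℂ}

theorem norm_exp_le (ω : ℝ) (z : ℂ) {y : ℝ} (hz : |z.im| ≤ y) :
    ‖exp (2 * (Real.pi : ℂ) * I * (ω : ℂ) * z)‖ ≤ Real.exp (2 * Real.pi * |ω| * y) := by
  rw [norm_exp, Real.exp_le_exp]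
  have h1 : (2 * (Real.pi : ℂ) * I * (ω : ℂ) * z).re = 2 * Real.pi * -(ω * z.im) := by
    simp [mul_assoc]
  have h2 : -(ω * z.im) ≤ |ω| * y :=
    (neg_le_abs _).trans ((abs_mul ω z.im).le.trans (by gcongr))
  rw [h1]
  nlinarith [Real.pi_pos]

theorem differentiable_laplace (hψ : Continuous ψ) (hs : HasCompactSupport ψ) :
    Differentiable ℂ (laplace ψ) := by
  intro z₀
  have hb : Integrable fun ω : ℝ ↦ ‖ψ ω‖ *
      ‖(2 * (Real.pi : ℂ) * I * (ω : ℂ))‖ * Real.exp (2 * Real.pi * |ω| * (|z₀.im| + 1)) := by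
    refine Continuous.integrable_of_hasCompactSupport (by fun_prop) ?_
    exact (hs.norm.mul_right (f' := fun ω : ℝ ↦ ‖(2 * (Real.pi : ℂ) * I * (ω : ℂ))‖)).mul_right
  refine (hasDerivAt_integral_of_dominated_loc_of_deriv_le (𝕜 := ℂ) (μ := volume)
    (F := fun z (ω : ℝ) ↦ ψ ω * exp (2 * (Real.pi : ℂ) * I * (ω : ℂ) * z))
    (F' := fun z (ω : ℝ) ↦ ψ ω * (exp (2 * (Real.pi : ℂ) * I * (ω : ℂ) * z) *
      (2 * (Real.pi : ℂ) * I * (ω : ℂ))))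
    (Metric.ball_mem_nhds z₀ one_pos) ?_ ?_ ?_ ?_ hb ?_).2.differentiableAt
  · exact Eventually.of_forall fun z ↦ (by fun_prop : Continuous _).aestronglyMeasurable
  · exact Continuous.integrable_of_hasCompactSupport (by fun_prop) hs.mul_right
  · exact (by fun_prop : Continuous _).aestronglyMeasurable
  · refine ae_of_all _ fun ω z hz ↦ ?_
    rw [norm_mul, norm_mul (exp _), mul_comm ‖exp _‖, mul_assoc ‖ψ ω‖]
    gcongr
    refine norm_exp_le ω z ?_
    rw [Metric.mem_ball, dist_eq_norm] at hz
    have h1 := abs_im_le_norm (z - z₀)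
    rw [sub_im] at h1
    linarith [abs_sub_abs_le_abs_sub z.im z₀.im]
  · refine ae_of_all _ fun ω z _ ↦ ?_
    have h1 : HasDerivAt (fun w : ℂ ↦ 2 * (Real.pi : ℂ) * I * (ω : ℂ) * w)
        (2 * (Real.pi : ℂ) * I * (ω : ℂ)) z := by
      simpa using (hasDerivAt_id z).const_mul (2 * (Real.pi : ℂ) * I * (ω : ℂ))
    exact h1.cexp.const_mul (ψ ω)

/-- Integration by parts; compact support removes the boundary terms. -/
theorem laplace_deriv (hψ : ContDiff ℝ 1 ψ) (hs : HasCompactSupport ψ) (z : ℂ) :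
    laplace (deriv ψ) z = -(2 * Real.pi * I * z) * laplace ψ z := by
  have hψ' : Continuous (deriv ψ) := hψ.continuous_deriv le_rfl
  have hψc := hψ.continuous
  set e : ℝ → ℂ := fun ω ↦ exp (2 * (Real.pi : ℂ) * I * (ω : ℂ) * z) with he
  have hec : Continuous e := by fun_prop
  have hder : ∀ ω : ℝ, HasDerivAt e (e ω * (2 * Real.pi * I * z)) ω := by
    intro ω
    have h1 : HasDerivAt (fun ω : ℝ ↦ 2 * (Real.pi : ℂ) * I * (ω : ℂ) * z)
        (2 * Real.pi * I * z) ω := by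
      simpa using ((hasDerivAt_id ω).ofReal_comp.const_mul (2 * (Real.pi : ℂ) * I)).mul_const z
    exact h1.cexp
  have h := integral_mul_deriv_eq_deriv_mul_of_integrable (u := ψ) (v := e)
    (u' := deriv ψ) (v' := fun ω ↦ e ω * (2 * Real.pi * I * z))
    (fun ω _ ↦ (hψ.differentiable one_ne_zero ω).hasDerivAt) (fun ω _ ↦ hder ω)
    (Continuous.integrable_of_hasCompactSupport (by fun_prop) hs.mul_right)
    (Continuous.integrable_of_hasCompactSupport (by fun_prop) hs.deriv.mul_right)
    (Continuous.integrable_of_hasCompactSupport (by fun_prop) hs.mul_right)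
  rw [laplace, ← neg_eq_iff_eq_neg.2 h, laplace, ← integral_const_mul, ← integral_neg]
  congr 1
  ext ω
  simp only [he]
  ring

/-- Each power of z is paid for by one derivative of ψ, and 2π ≥ 1 lets the constant be dropped. The
quantifier over ψ stays inside because the induction passes to `deriv ψ`. -/
theorem exists_norm_pow_mul_laplace_le (k : ℕ) (y : ℝ) :
    ∀ ψ : ℝ → ℂ, ContDiff ℝ (⊤ : ℕ∞) ψ → HasCompactSupport ψ →
      ∃ C : ℝ, ∀ z : ℂ, |z.im| ≤ y → ‖z‖ ^ k * ‖laplace ψ z‖ ≤ C := by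
  induction k with
  | zero =>
    intro ψ hψ hs
    have hψc := hψ.continuous
    refine ⟨∫ ω : ℝ, ‖ψ ω‖ * Real.exp (2 * Real.pi * |ω| * y), fun z hz ↦ ?_⟩
    rw [pow_zero, one_mul]
    refine norm_integral_le_of_norm_le
      (Continuous.integrable_of_hasCompactSupport (by fun_prop) hs.norm.mul_right)
      (ae_of_all _ fun ω ↦ ?_)
    rw [norm_mul]
    gcongr
    exact norm_exp_le ω z hz
  | succ k ih =>
    intro ψ hψ hs
    obtain ⟨C, hC⟩ := ih (deriv ψ) (contDiff_infty_iff_deriv.1 hψ).2 hs.deriv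
    refine ⟨C, fun z hz ↦ ?_⟩
    refine le_trans ?_ (hC z hz)
    rw [laplace_deriv (hψ.of_le (by exact_mod_cast le_top)) hs, norm_mul, norm_neg, norm_mul,
      norm_mul, norm_mul, norm_I, Complex.norm_real, Real.norm_eq_abs, abs_of_pos Real.pi_pos,
      pow_succ, mul_assoc]
    have h1 : 1 ≤ 2 * Real.pi := by linarith [Real.pi_gt_three]
    have h2 : ‖z‖ * ‖laplace ψ z‖ ≤ 2 * Real.pi * (‖z‖ * ‖laplace ψ z‖) :=
      le_mul_of_one_le_left (by positivity) h1
    simp only [RCLike.norm_ofNat, mul_one]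
    rw [mul_assoc (2 * Real.pi)]
    gcongr

theorem exists_norm_laplace_le (hψ : ContDiff ℝ (⊤ : ℕ∞) ψ) (hs : HasCompactSupport ψ) (k : ℕ) (y : ℝ) :
    ∃ C : ℝ, ∀ z : ℂ, |z.im| ≤ y → ‖laplace ψ z‖ ≤ C / (1 + |z.re|) ^ k := by
  obtain ⟨C₀, hC₀⟩ := exists_norm_pow_mul_laplace_le 0 y ψ hψ hs
  obtain ⟨C₁, hC₁⟩ := exists_norm_pow_mul_laplace_le k y ψ hψ hs
  refine ⟨2 ^ (k - 1) * (C₀ + C₁), fun z hz ↦ ?_⟩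
  rw [le_div_iff₀ (by positivity)]
  have h1 := hC₀ z hz
  have h2 := hC₁ z hz
  rw [pow_zero] at h1
  calc ‖laplace ψ z‖ * (1 + |z.re|) ^ k
      ≤ ‖laplace ψ z‖ * (2 ^ (k - 1) * (1 ^ k + ‖z‖ ^ k)) := by
        gcongr
        refine le_trans ?_ (add_pow_le zero_le_one (norm_nonneg z) k)
        gcongr
        exact abs_re_le_norm z
    _ = 2 ^ (k - 1) * (1 * ‖laplace ψ z‖ + ‖z‖ ^ k * ‖laplace ψ z‖) := by rw [one_pow]; ring
    _ ≤ _ := by gcongr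

theorem laplace_neg (hψ : ∀ ω, ψ (-ω) = ψ ω) (z : ℂ) : laplace ψ (-z) = laplace ψ z := by
  rw [laplace, laplace, ← integral_neg_eq_self]
  congr 1
  ext ω
  rw [hψ]
  congr 2
  push_cast
  ring

end PaleyWiener

/-! ### The weight H -/

namespace TauTwist

open Complex Set Filter Topology MeasureTheory

open PaleyWiener

theorem fourier_neg_of_even {φ : SchwartzMap ℝ ℂ} (hφ : ∀ x : ℝ, φ (-x) = φ x) (ω : ℝ) :
    (𝓕 φ) (-ω) = (𝓕 φ) ω := by
  rw [SchwartzMap.fourier_coe, Real.fourier_eq', Real.fourier_eq', ← integral_neg_eq_self]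
  congr 1
  ext x
  rw [hφ]
  simp

variable {φ : SchwartzMap ℝ ℂ}

theorem complexExtension_eq_laplace : complexExtension φ = laplace (𝓕 φ : SchwartzMap ℝ ℂ) := rfl

theorem differentiable_weightH
    (hs : HasCompactSupport (FourierTransform.fourier φ : SchwartzMap ℝ ℂ)) :
    Differentiable ℂ (weightH φ) := by
  have := differentiable_laplace (SchwartzMap.continuous _) hs
  exact this.comp (by fun_prop : Differentiable ℂ fun s : ℂ ↦ (s - 1 / 2) / I)

theorem weightH_one_sub (hφ : ∀ x : ℝ, φ (-x) = φ x) (s : ℂ) :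
    weightH φ (1 - s) = weightH φ s := by
  rw [weightH, weightH, complexExtension_eq_laplace, ← laplace_neg (fourier_neg_of_even hφ)]
  congr 1
  ring

theorem weightH_half_add (γ : ℝ) : weightH φ (1 / 2 + γ * I) = φ γ := by
  rw [weightH, ← complexExtension_ofReal]
  congr 1
  field_simp
  ring

/-- Under z = (s - 1/2)/i the strip -1/2 ≤ Re s ≤ 3/2 becomes |Im z| ≤ 1, with Re z = Im s. -/
theorem exists_norm_weightH_le
    (hs : HasCompactSupport (FourierTransform.fourier φ : SchwartzMap ℝ ℂ)) (k : ℕ) :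
    ∃ C : ℝ, ∀ s : ℂ, -(1 / 2) ≤ s.re → s.re ≤ 3 / 2 → ‖weightH φ s‖ ≤ C / (1 + |s.im|) ^ k := by
  obtain ⟨C, hC⟩ := exists_norm_laplace_le (SchwartzMap.smooth _ ⊤) hs k 1
  refine ⟨C, fun s h1 h2 ↦ ?_⟩
  have h3 := hC ((s - 1 / 2) / I)
  have hre : ((s - 1 / 2) / I).re = s.im := by simp [div_I]
  have him : ((s - 1 / 2) / I).im = -(s.re - 1 / 2) := by simp [div_I]
  rw [hre, him, abs_neg] at h3
  exact h3 (abs_le.2 ⟨by linarith, by linarith⟩)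

end TauTwist

/-! ### Primitive quadratic characters -/

namespace DirichletCharacter

theorem exists_eq_intCast {D : ℕ} [NeZero D] {k : ℤ → ℤ} (h1 : k 1 = 1)
    (hmul : ∀ a b, k (a * b) = k a * k b) (hper : ∀ n, k (n % D) = k n)
    (h0 : ∀ n : ℤ, ¬ IsCoprime n D → k n = 0) :
    ∃ χ : DirichletCharacter ℂ D, ∀ n : ℤ, χ n = k n := by
  have hk : ∀ n : ℤ, k ((n : ZMod D).val : ℤ) = k n := fun n ↦ by rw [ZMod.val_intCast, hper]
  have hk' : ∀ a : ZMod D, ∃ n : ℤ, (n : ZMod D) = a := fun a ↦ ZMod.intCast_surjective a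
  refine ⟨{ toFun := fun a ↦ (k (a.val : ℤ) : ℂ), map_one' := ?_, map_mul' := ?_,
            map_nonunit' := ?_ }, fun n ↦ ?_⟩
  · have := hk 1
    rw [Int.cast_one] at this
    rw [this, h1, Int.cast_one]
  · intro a b
    obtain ⟨a, rfl⟩ := hk' a
    obtain ⟨b, rfl⟩ := hk' b
    rw [← Int.cast_mul, hk, hk, hk, hmul, Int.cast_mul]
  · intro a ha
    obtain ⟨a, rfl⟩ := hk' a
    change ((k _ : ℤ) : ℂ) = 0
    rw [hk, h0, Int.cast_zero]
    rwa [ZMod.coe_int_isUnit_iff_isCoprime, isCoprime_comm] at ha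
  · change ((k _ : ℤ) : ℂ) = _
    rw [hk]

/-- A conductor properly dividing D divides D/p for some prime p, and then χ takes only the values 0
and 1 on integers congruent to 1 mod D/p. -/
theorem isPrimitive_of_exists_ne_one {D : ℕ} [NeZero D] {χ : DirichletCharacter ℂ D}
    (h : ∀ p : ℕ, p.Prime → p ∣ D → ∃ a : ℤ, a ≡ 1 [ZMOD (D / p : ℕ)] ∧ χ a ≠ 0 ∧ χ a ≠ 1) :
    χ.IsPrimitive := by
  by_contra hne
  obtain ⟨m, hm⟩ := χ.conductor_dvd_level
  have hm1 : m ≠ 1 := by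
    rintro rfl
    rw [mul_one] at hm
    exact hne hm.symm
  obtain ⟨p, hp, q, rfl⟩ := Nat.exists_prime_and_dvd hm1
  have hpD : p ∣ D := ⟨χ.conductor * q, hm.trans (by ring)⟩
  obtain ⟨a, ha, ha0, ha1⟩ := h p hp hpD
  have hc : χ.conductor ∣ D / p :=
    ⟨q, (Nat.div_eq_iff_eq_mul_left hp.pos hpD).2 (hm.trans (by ring))⟩
  apply ha1
  have hf := χ.factorsThrough_conductor
  rw [hf.eq_changeLevel, changeLevel_eq_cast_of_dvd' _ hf.dvd ((χ.apply_ne_zero_iff a).1 ha0)]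
  have : (a : ZMod χ.conductor) = ((1 : ℤ) : ZMod χ.conductor) :=
    (ZMod.intCast_eq_intCast_iff _ _ _).2 (ha.of_dvd (by exact_mod_cast hc))
  rw [this, Int.cast_one, map_one]

/-- Primitivity is tested prime by prime through the Chinese remainder theorem: at 2 with the given
u, at an odd p dividing M with a nonresidue mod p, the witness being 1 modulo the complementary
factor. `hu` says that ψ is primitive and `heven` that the product is even. -/
theorem exists_primitive_of_mulChar_mul_jacobiSym {e M : ℕ} [NeZero e] (he : e ∣ 8) (hM : _root_.Odd M)
    (hsq : Squarefree M) (ψ : MulChar (ZMod e) ℤ) (hψ : ψ.IsQuadratic)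
    (hu : e = 1 ∨ 2 ∣ e ∧ ∃ u : ℕ, u ≡ 1 [MOD e / 2] ∧ ψ u = -1)
    (heven : ψ (-1) * jacobiSym (-1) M = 1) :
    ∃ χ : DirichletCharacter ℂ (e * M), χ.IsPrimitive ∧ χ.IsQuadratic ∧ χ (-1) = 1 ∧
      ∀ n : ℤ, χ n = (ψ n * jacobiSym n M : ℤ) := by
  have : NeZero M := ⟨hsq.ne_zero⟩
  have hcop : Nat.Coprime e M :=
    Nat.Coprime.coprime_dvd_left he ((Nat.coprime_two_left.2 hM).pow_left 3)
  obtain ⟨χ, hχ⟩ : ∃ χ : DirichletCharacter ℂ (e * M),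
      ∀ n : ℤ, χ n = ((fun n : ℤ ↦ ψ n * jacobiSym n M) n : ℤ) := by
    refine exists_eq_intCast ?_ ?_ ?_ ?_
    · simp
    · intro a b
      simp only [Int.cast_mul, map_mul, jacobiSym.mul_left]
      ring
    · intro n
      have h1 : n % (e * M : ℕ) ≡ n [ZMOD (e * M : ℕ)] := Int.mod_modEq _ _
      have h2 := h1.of_dvd (by push_cast; exact dvd_mul_right _ _ : (e : ℤ) ∣ (e * M : ℕ))
      have h3 := h1.of_dvd (by push_cast; exact dvd_mul_left _ _ : (M : ℤ) ∣ (e * M : ℕ))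
      simp only [(ZMod.intCast_eq_intCast_iff _ _ _).2 h2, jacobiSym.mod_left' h3]
    · intro n hn
      rw [Nat.cast_mul, IsCoprime.mul_right_iff, not_and_or] at hn
      rcases hn with hn | hn
      · rw [isCoprime_comm, ← ZMod.coe_int_isUnit_iff_isCoprime] at hn
        simp [ψ.map_nonunit hn]
      · rw [Int.isCoprime_iff_gcd_eq_one] at hn
        simp [jacobiSym.eq_zero_iff_not_coprime.2 hn]
  refine ⟨χ, isPrimitive_of_exists_ne_one fun p hp hpD ↦ ?_, fun a ↦ ?_, ?_, hχ⟩
  · suffices ∃ a : ℤ, a ≡ 1 [ZMOD (e * M / p : ℕ)] ∧ ψ a * jacobiSym a M = -1 by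
      obtain ⟨a, ha, hka⟩ := this
      refine ⟨a, ha, ?_⟩
      rw [hχ]
      simp only [hka]
      norm_num
    rcases (hp.dvd_mul).1 hpD with hpe | hpM
    · obtain rfl : p = 2 :=
        (Nat.prime_dvd_prime_iff_eq hp Nat.prime_two).1 (hp.dvd_of_dvd_pow (n := 3) (hpe.trans he))
      rcases hu with rfl | ⟨⟨f, rfl⟩, u, hu1, hu⟩
      · omega
      obtain ⟨a, ha1, ha2⟩ := Nat.chineseRemainder hcop u 1
      refine ⟨a, ?_, ?_⟩
      · rw [mul_assoc, Nat.mul_div_cancel_left _ two_pos]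
        rw [Nat.mul_div_cancel_left _ two_pos] at hu1
        have hf : Nat.Coprime f M := hcop.coprime_dvd_left (dvd_mul_left _ _)
        have := (Nat.modEq_and_modEq_iff_modEq_mul hf).1
          ⟨(ha1.of_dvd (dvd_mul_left _ _)).trans hu1, ha2⟩
        exact_mod_cast this
      · have h1 : ((a : ℤ) : ZMod (2 * f)) = u := by
          rw [Int.cast_natCast]
          exact (ZMod.natCast_eq_natCast_iff _ _ _).2 ha1
        have h2 : jacobiSym a M = jacobiSym 1 M :=
          jacobiSym.mod_left' (by exact_mod_cast ha2)
        rw [h1, h2, hu, jacobiSym.one_left, mul_one]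
    · obtain ⟨N, rfl⟩ := hpM
      have : Fact p.Prime := ⟨hp⟩
      have hpodd : p ≠ 2 := by
        rintro rfl
        exact (Nat.not_even_iff_odd.2 hM) (even_two.mul_right _)
      have hpN : Nat.Coprime p N := Nat.coprime_of_squarefree_mul hsq
      have hpe : Nat.Coprime p e := (hcop.coprime_dvd_right (dvd_mul_right _ _)).symm
      obtain ⟨r, hr⟩ := FiniteField.exists_nonsquare (F := ZMod p) (by rwa [ZMod.ringChar_zmod_n])
      obtain ⟨a, ha1, ha2⟩ := Nat.chineseRemainder (hpe.mul_right hpN) r.val 1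
      refine ⟨a, ?_, ?_⟩
      · rw [show e * (p * N) = p * (e * N) by ring, Nat.mul_div_cancel_left _ hp.pos]
        exact_mod_cast ha2
      · have hN : N ≠ 0 := by rintro rfl; simp at hsq
        have h1 : ((a : ℤ) : ZMod e) = 1 := by
          have := (ZMod.natCast_eq_natCast_iff _ _ _).2 (ha2.of_dvd (dvd_mul_right _ _))
          simpa using this
        have h2 : jacobiSym a N = jacobiSym 1 N :=
          jacobiSym.mod_left' (by exact_mod_cast ha2.of_dvd (dvd_mul_left _ _))
        have h3 : jacobiSym a p = -1 := by
          apply ZMod.nonsquare_iff_jacobiSym_eq_neg_one.2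
          have : ((a : ℤ) : ZMod p) = r := by
            have := (ZMod.natCast_eq_natCast_iff _ _ _).2 ha1
            simpa using this
          rwa [this]
        rw [jacobiSym.mul_right' _ hp.ne_zero hN, h1, h2, h3, map_one, jacobiSym.one_left]
        norm_num
  · obtain ⟨n, rfl⟩ := ZMod.intCast_surjective a
    rw [hχ]
    rcases hψ n with h | h | h <;> rcases jacobiSym.trichotomy n M with h' | h' | h' <;>
      simp [h, h']
  · have := hχ (-1)
    rw [Int.cast_neg, Int.cast_one] at this
    rw [this]
    simp [heven]

end DirichletCharacter

/-! ### The Kronecker symbol as a primitive even character -/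

namespace TauTwist

/-- Reciprocity has no sign for D ≡ 1 mod 4, and the value at 2 in the definition is (2/D). At n = 0
both sides vanish unless D = 1. -/
theorem kroneckerSymbol_of_one_mod_four {D : ℕ} (hD : D % 4 = 1) (n : ℕ) :
    kroneckerSymbol D n = jacobiSym n D := by
  have hodd : Odd D := Nat.odd_iff.2 (by omega)
  rw [kroneckerSymbol]
  split_ifs with hn h
  · obtain rfl : D = 1 := by simpa using h
    simp
  · rw [hn, Nat.cast_zero, jacobiSym.zero_left (by omega)]
  · have hodd' : Odd (n / 2 ^ n.factorization 2) :=
      Nat.odd_iff.2 (Nat.two_dvd_ne_zero.1 (Nat.not_dvd_ordCompl Nat.prime_two hn))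
    rw [jacobiSym.quadratic_reciprocity_one_mod_four hD hodd']
    conv_rhs => rw [← Nat.ordProj_mul_ordCompl_eq_self n 2]
    rw [Nat.cast_mul, jacobiSym.mul_left, Nat.cast_pow, jacobiSym.pow_left, Nat.cast_ofNat,
      jacobiSym.at_two hodd, Int.cast_natCast]

theorem kroneckerSymbol_four_mul_of_even {m : ℤ} {n : ℕ} (hn : Even n) :
    kroneckerSymbol (4 * m) n = 0 := by
  rw [kroneckerSymbol]
  split_ifs with h0 h
  · omega
  · rfl
  · have : ZMod.χ₈ ((4 * m : ℤ) : ZMod 8) = 0 := by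
      rw [ZMod.χ₈_int_eq_if_mod_eight, if_pos (by omega)]
    rw [this, zero_pow, zero_mul]
    exact (Nat.Prime.factorization_pos_of_dvd Nat.prime_two h0 hn.two_dvd).ne'

theorem kroneckerSymbol_four_mul_of_odd {m : ℤ} {n : ℕ} (hn : Odd n) :
    kroneckerSymbol (4 * m) n = jacobiSym m n := by
  have h0 : n ≠ 0 := hn.pos.ne'
  have h2 : n.factorization 2 = 0 :=
    Nat.factorization_eq_zero_of_not_dvd (by rwa [← even_iff_two_dvd, Nat.not_even_iff_odd])
  rw [kroneckerSymbol, if_neg h0, h2, pow_zero, pow_zero, one_mul, Nat.div_one,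
    jacobiSym.mul_left, jacobiSym.at_four hn, one_mul]

theorem jacobiSym_eq_χ₄_mul {m n : ℕ} (hm : m % 4 = 3) (hn : Odd n) :
    jacobiSym m n = ZMod.χ₄ n * jacobiSym n m := by
  rw [jacobiSym.quadratic_reciprocity (Nat.odd_iff.2 (by omega)) hn, pow_mul,
    ZMod.neg_one_pow_div_two_of_three_mod_four hm, ZMod.χ₄_eq_neg_one_pow (Nat.odd_iff.1 hn)]

theorem χ₄_natCast_of_even {n : ℕ} (hn : Even n) : ZMod.χ₄ (n : ZMod 4) = 0 := by
  rw [ZMod.χ₄_nat_eq_if_mod_four, if_pos (Nat.even_iff.1 hn)]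

theorem χ₈_natCast_of_even {n : ℕ} (hn : Even n) : ZMod.χ₈ (n : ZMod 8) = 0 := by
  rw [ZMod.χ₈_nat_eq_if_mod_eight, if_pos (Nat.even_iff.1 hn)]

theorem χ₈'_natCast_of_even {n : ℕ} (hn : Even n) : ZMod.χ₈' (n : ZMod 8) = 0 := by
  rw [ZMod.χ₈'_nat_eq_if_mod_eight, if_pos (Nat.even_iff.1 hn)]

theorem exists_primitive_character {d : ℤ} (hd : IsFundamentalDiscriminant d) (hpos : 0 < d) :
    ∃ D : ℕ, D ≠ 0 ∧ (D : ℤ) = d ∧ ∃ χ : DirichletCharacter ℂ D, χ.IsPrimitive ∧ χ.IsQuadratic ∧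
      χ (-1) = 1 ∧ ∀ n : ℕ, (kroneckerSymbol d n : ℂ) = χ n := by
  suffices ∃ e M : ℕ, e * M ≠ 0 ∧ ((e * M : ℕ) : ℤ) = d ∧ ∃ χ : DirichletCharacter ℂ (e * M),
      χ.IsPrimitive ∧ χ.IsQuadratic ∧ χ (-1) = 1 ∧ ∀ n : ℕ, (kroneckerSymbol d n : ℂ) = χ n by
    obtain ⟨e, M, h0, h⟩ := this
    exact ⟨e * M, h0, h⟩
  rcases hd with ⟨h4, hsq⟩ | ⟨m, rfl, hm4, hsq⟩
  · lift d to ℕ using hpos.le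
    rw [Int.squarefree_natCast] at hsq
    have hodd : Odd d := Nat.odd_iff.2 (by omega)
    obtain ⟨χ, h1, h2, h3, h⟩ := DirichletCharacter.exists_primitive_of_mulChar_mul_jacobiSym
      (e := 1) (by norm_num) hodd hsq (1 : MulChar (ZMod 1) ℤ) (fun a ↦ Or.inr (Or.inl (by
        rw [MulChar.one_apply (isUnit_of_subsingleton a)]))) (Or.inl rfl) (by
        rw [MulChar.one_apply (isUnit_of_subsingleton _), jacobiSym.at_neg_one hodd,
          ZMod.χ₄_nat_one_mod_four (by omega), one_mul])
    refine ⟨1, d, by omega, by simp, χ, h1, h2, h3, fun n ↦ ?_⟩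
    rw [kroneckerSymbol_of_one_mod_four (by omega), ← Int.cast_natCast (R := ZMod (1 * d)), h n,
      MulChar.one_apply (isUnit_of_subsingleton _), one_mul]
  · lift m to ℕ using by omega
    rw [Int.squarefree_natCast] at hsq
    have key : ∀ (e M : ℕ), ((e * M : ℕ) : ℤ) = 4 * m → ∀ ψ : MulChar (ZMod e) ℤ,
        (∀ n : ℕ, Even n → ψ n = 0) → (∀ n : ℕ, Odd n → jacobiSym m n = ψ n * jacobiSym n M) →
        (∃ χ : DirichletCharacter ℂ (e * M), χ.IsPrimitive ∧ χ.IsQuadratic ∧ χ (-1) = 1 ∧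
          ∀ n : ℤ, χ n = (ψ n * jacobiSym n M : ℤ)) →
        ∃ e M : ℕ, e * M ≠ 0 ∧ ((e * M : ℕ) : ℤ) = 4 * m ∧ ∃ χ : DirichletCharacter ℂ (e * M),
          χ.IsPrimitive ∧ χ.IsQuadratic ∧ χ (-1) = 1 ∧
            ∀ n : ℕ, (kroneckerSymbol (4 * m) n : ℂ) = χ n := by
      rintro e M h ψ hψ hψ' ⟨χ, h1, h2, h3, hχ⟩
      refine ⟨e, M, fun h0 ↦ by rw [h0] at h; simp at h; omega, h, χ, h1, h2, h3, fun n ↦ ?_⟩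
      have := hχ n
      rw [Int.cast_natCast] at this
      rw [this]
      rcases Nat.even_or_odd n with hn | hn
      · rw [kroneckerSymbol_four_mul_of_even hn, Int.cast_natCast, hψ n hn, zero_mul]
      · rw [kroneckerSymbol_four_mul_of_odd hn, hψ' n hn, Int.cast_natCast]
    -- The 2-part is `χ₈` for m = 2M with M ≡ 1 mod 4, `χ₈'` for m = 2M with M ≡ 3, and `χ₄` for m ≡
    -- 3. The reciprocity sign `χ₄` is absorbed in it, so its parity matches that of the Jacobi
    -- symbol. The witness 5 is 1 mod 4 and has value -1 under both characters mod 8; 3 plays this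
    -- role mod 4.
    rcases hm4 with h4 | h4
    · obtain ⟨M, rfl⟩ : 2 ∣ m := by omega
      have hM : Odd M := Nat.odd_iff.2 (by omega)
      have hMsq := hsq.squarefree_of_dvd (dvd_mul_left M 2)
      have h2M : ∀ n : ℕ, Odd n → jacobiSym ((2 * M : ℕ) : ℤ) n = ZMod.χ₈ n * jacobiSym M n := by
        intro n hn
        rw [Nat.cast_mul, jacobiSym.mul_left, Nat.cast_ofNat, jacobiSym.at_two hn]
      rcases Nat.odd_mod_four_iff.1 (Nat.odd_iff.1 hM) with hM4 | hM4
      · refine key 8 M (by push_cast; ring) ZMod.χ₈ (fun n ↦ χ₈_natCast_of_even) (fun n hn ↦ ?_)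
          (DirichletCharacter.exists_primitive_of_mulChar_mul_jacobiSym (by norm_num) hM hMsq _
            ZMod.isQuadratic_χ₈ (Or.inr ⟨by norm_num, 5, by decide, by decide⟩) ?_)
        · rw [h2M n hn, jacobiSym.quadratic_reciprocity_one_mod_four hM4 hn]
        · rw [jacobiSym.at_neg_one hM, ZMod.χ₄_nat_one_mod_four hM4]
          decide
      · refine key 8 M (by push_cast; ring) ZMod.χ₈' (fun n ↦ χ₈'_natCast_of_even) (fun n hn ↦ ?_)
          (DirichletCharacter.exists_primitive_of_mulChar_mul_jacobiSym (by norm_num) hM hMsq _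
            ZMod.isQuadratic_χ₈' (Or.inr ⟨by norm_num, 5, by decide, by decide⟩) ?_)
        · have := ZMod.χ₈'_int_eq_χ₄_mul_χ₈ n
          simp only [Int.cast_natCast] at this
          rw [h2M n hn, jacobiSym_eq_χ₄_mul hM4 hn, this]
          ring
        · rw [jacobiSym.at_neg_one hM, ZMod.χ₄_nat_three_mod_four hM4]
          decide
    · have hm : Odd m := Nat.odd_iff.2 (by omega)
      refine key 4 m (by push_cast; ring) ZMod.χ₄ (fun n ↦ χ₄_natCast_of_even) (fun n hn ↦ ?_)
          (DirichletCharacter.exists_primitive_of_mulChar_mul_jacobiSym (by norm_num) hm hsq _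
            ZMod.isQuadratic_χ₄ (Or.inr ⟨by norm_num, 3, by decide, by decide⟩) ?_)
      · rw [jacobiSym_eq_χ₄_mul (by omega) hn]
      · rw [jacobiSym.at_neg_one hm, ZMod.χ₄_nat_three_mod_four (by omega)]
        decide

end TauTwist

/-! ### Modularity of Δ -/

namespace ModularForm

open Complex UpperHalfPlane MatrixGroups

theorem discriminant_smul (g : SL(2, ℤ)) (z : ℍ) :
    discriminant (g • z) = (g 1 0 * z + g 1 1) ^ 12 * discriminant z := by
  have h := SlashInvariantForm.slash_action_eqn' (Γ := 𝒮ℒ) CuspForm.discriminant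
    (γ := Matrix.SpecialLinearGroup.mapGL ℝ g) (MonoidHom.mem_range.2 ⟨g, rfl⟩) z
  have h1 : (Matrix.SpecialLinearGroup.mapGL ℝ g) 1 0 = ((g 1 0 : ℤ) : ℝ) := rfl
  have h2 : (Matrix.SpecialLinearGroup.mapGL ℝ g) 1 1 = ((g 1 1 : ℤ) : ℝ) := rfl
  rw [h1, h2, ofReal_intCast, ofReal_intCast] at h
  exact_mod_cast h

theorem eta_pow_moebius {a b c d : ℤ} (h : a * d - b * c = 1) {z : ℂ} (hz : 0 < z.im) :
    eta ((a * z + b) / (c * z + d)) ^ 24 = (c * z + d) ^ 12 * eta z ^ 24 := by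
  obtain ⟨g, hg⟩ : ∃ g : SL(2, ℤ), (g : Matrix (Fin 2) (Fin 2) ℤ) = !![a, b; c, d] :=
    ⟨⟨!![a, b; c, d], by rw [Matrix.det_fin_two_of, h]⟩, rfl⟩
  have := discriminant_smul g ⟨z, hz⟩
  rw [discriminant, discriminant, coe_specialLinearGroup_apply] at this
  simpa [hg] using this

end ModularForm

/-! ### Mean square bound for τ -/

namespace TauTwist

open Complex Set Filter Topology MeasureTheory

theorem continuousOn_eta_pow : ContinuousOn (fun z ↦ ModularForm.eta z ^ 24) {z : ℂ | 0 < z.im} :=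
  fun _ hz ↦ ((ModularForm.differentiableAt_eta_of_mem_upperHalfPlaneSet
    hz).continuousAt.pow 24).continuousWithinAt

theorem hasSum_tau {z : ℂ} (hz : 0 < z.im) :
    HasSum (fun n : ℕ ↦ tau n * exp (2 * Real.pi * I * n * z)) (ModularForm.eta z ^ 24) := by
  have := ModularForm.hasSum_qExpansion CuspForm.discriminant one_pos one_mem_strictPeriods_SL
    ⟨z, hz⟩
  convert! this using 2 with n
  rw [Function.Periodic.qParam, ← Complex.exp_nat_mul]
  congr 2
  simp
  ring

theorem tau_zero : tau 0 = 0 :=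
  CuspFormClass.qExpansion_coeff_zero CuspForm.discriminant one_pos one_mem_strictPeriods_SL

theorem tau_eq_integral (n : ℕ) {y : ℝ} (hy : 0 < y) :
    tau n = exp (2 * Real.pi * n * y) *
      ∫ u in (0 : ℝ)..1, exp (-(2 * Real.pi * I * n * u)) * ModularForm.eta (u + y * I) ^ 24 := by
  have := ModularFormClass.qExpansion_coeff_eq_intervalIntegral CuspForm.discriminant one_pos
    one_mem_strictPeriods_SL n hy
  rw [← intervalIntegral.integral_const_mul]
  refine this.trans ?_
  rw [ofReal_one, div_one, one_mul]
  congr 1 with u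
  rw [← mul_assoc, ← Complex.exp_add]
  congr 1
  rw [Function.Periodic.qParam, ← Complex.exp_nat_mul, one_div, ← Complex.exp_neg]
  congr 1
  simp only [ofReal_one, div_one]
  linear_combination (-(2 * Real.pi * n * y : ℂ)) * I_sq

/-- Parseval on the horizontal line of height y = 1/N, where |Δ|^2 ≤ C^2 N^12 by the cusp form
bound. For n ≤ N, undoing the damping exp(-2πny) costs at most exp(4π) in the square. -/
theorem sum_norm_sq_tau_le : ∃ C : ℝ, 0 ≤ C ∧
    ∀ N : ℕ, 0 < N → ∑ n ∈ Finset.Icc 1 N, ‖tau n‖ ^ 2 ≤ C * (N : ℝ) ^ 12 := by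
  obtain ⟨C, hC⟩ := CuspFormClass.exists_bound CuspForm.discriminant
  have hCn : ∀ (u : ℝ) {y : ℝ}, 0 < y → ‖ModularForm.eta (u + y * I) ^ 24‖ ^ 2 ≤ C ^ 2 / y ^ 12 := by
    intro u y hy
    have h := hC ⟨u + y * I, by simpa using hy⟩
    have him : UpperHalfPlane.im ⟨u + y * I, by simpa using hy⟩ = y := by
      change ((u : ℂ) + y * I).im = y
      simp
    rw [him, show (((12 : ℤ) : ℝ) / 2) = ((6 : ℕ) : ℝ) by norm_num, Real.rpow_natCast] at h
    calc _ ≤ (C / y ^ 6) ^ 2 := pow_le_pow_left₀ (norm_nonneg _) h 2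
      _ = _ := by rw [div_pow, ← pow_mul]
  refine ⟨Real.exp (4 * Real.pi) * C ^ 2, by positivity, fun N hN ↦ ?_⟩
  have hN' : (0 : ℝ) < N := by exact_mod_cast hN
  set y : ℝ := 1 / N with hy_def
  have hy : 0 < y := by positivity
  set f : ℝ → ℂ := fun u ↦ ModularForm.eta (u + y * I) ^ 24 with hf_def
  have hf : Continuous f := by
    refine continuousOn_eta_pow.comp_continuous (by fun_prop) fun u ↦ ?_
    simpa using hy
  have hL2 : MemLp f 2 (volume.restrict (Ioc 0 1)) := by
    refine MemLp.of_bound hf.aestronglyMeasurable (√(C ^ 2 / y ^ 12)) (.of_forall fun u ↦ ?_)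
    exact Real.le_sqrt_of_sq_le (hCn u hy)
  have hP := hasSum_sq_fourierCoeffOn zero_lt_one hL2
  have hint : ((1 : ℝ) - 0)⁻¹ • ∫ x in (0 : ℝ)..1, ‖f x‖ ^ 2 ≤ C ^ 2 / y ^ 12 := by
    rw [sub_zero, inv_one, one_smul]
    calc _ ≤ ∫ x in (0 : ℝ)..1, C ^ 2 / y ^ 12 :=
          intervalIntegral.integral_mono_on zero_le_one ((hf.norm.pow 2).intervalIntegrable _ _)
            intervalIntegrable_const fun u _ ↦ hCn u hy
      _ = _ := by simp
  have hcoeff : ∀ n : ℕ, n ≤ N →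
      ‖tau n‖ ^ 2 ≤ Real.exp (4 * Real.pi) * ‖fourierCoeffOn zero_lt_one f n‖ ^ 2 := by
    intro n hn
    have h1 : tau n = exp (2 * Real.pi * n * y) * fourierCoeffOn zero_lt_one f n := by
      rw [tau_eq_integral n hy, fourierCoeffOn_eq_integral]
      congr 1
      rw [sub_zero, div_one, one_smul]
      congr 1 with u
      rw [fourier_coe_apply, smul_eq_mul]
      congr 2
      push_cast
      ring
    have h2 : ‖exp (2 * Real.pi * n * y)‖ ^ 2 ≤ Real.exp (4 * Real.pi) := by
      have : (2 * Real.pi * n * y : ℂ) = ((2 * Real.pi * n * y : ℝ) : ℂ) := by push_cast; ring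
      rw [this, ← ofReal_exp, norm_real, Real.norm_eq_abs, Real.abs_exp, ← Real.exp_nat_mul,
        Real.exp_le_exp]
      have h3 : (n : ℝ) * y ≤ 1 := by
        rw [hy_def, mul_one_div, div_le_one hN']
        exact_mod_cast hn
      push_cast
      nlinarith [Real.pi_pos]
    rw [h1, norm_mul, mul_pow]
    gcongr
  calc ∑ n ∈ Finset.Icc 1 N, ‖tau n‖ ^ 2
      ≤ ∑ n ∈ Finset.Icc 1 N, Real.exp (4 * Real.pi) * ‖fourierCoeffOn zero_lt_one f n‖ ^ 2 :=
        Finset.sum_le_sum fun n hn ↦ hcoeff n (Finset.mem_Icc.1 hn).2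
    _ = Real.exp (4 * Real.pi) * ∑ i ∈ (Finset.Icc 1 N).map Nat.castEmbedding,
          ‖fourierCoeffOn zero_lt_one f i‖ ^ 2 := by
        rw [← Finset.mul_sum, Finset.sum_map]
        rfl
    _ ≤ Real.exp (4 * Real.pi) * (C ^ 2 / y ^ 12) := by
        gcongr
        exact (sum_le_hasSum _ (fun _ _ ↦ by positivity) hP).trans hint
    _ = _ := by
        rw [hy_def]
        field_simp

/-- With σ = 13/2 + δ, the inequality xy ≤ x^2 + y^2 bounds each term by |τ(n)|^2/n^(12+δ) +
1/n^(1+δ). The mean square therefore suffices for Re s > 1, without Deligne's bound. -/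
theorem summable_norm_tau_div {σ : ℝ} (hσ : 13 / 2 < σ) :
    Summable fun n : ℕ ↦ ‖tau n‖ / (n : ℝ) ^ σ := by
  obtain ⟨C, hC0, hC⟩ := sum_norm_sq_tau_le
  set δ : ℝ := σ - 13 / 2 with hδ
  have h1 : LSeriesSummable (fun n ↦ ((‖tau n‖ ^ 2 : ℝ) : ℂ)) ((12 + δ : ℝ) : ℂ) := by
    refine LSeriesSummable_of_sum_norm_bigO (r := 12) ?_ (by norm_num) ?_
    · refine Asymptotics.IsBigO.of_bound C ?_
      filter_upwards [eventually_gt_atTop 0] with N hN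
      have : ∀ x : ℝ, ‖x ^ 2‖ = x ^ 2 := fun x ↦ Real.norm_of_nonneg (sq_nonneg x)
      simp only [norm_real, this]
      rw [Real.norm_of_nonneg (Finset.sum_nonneg fun _ _ ↦ by positivity),
        Real.norm_of_nonneg (by positivity)]
      have := hC N hN
      rw [← Real.rpow_natCast] at this
      exact_mod_cast this
    · rw [ofReal_re]
      linarith
  have h2 : Summable fun n : ℕ ↦ 1 / (n : ℝ) ^ (1 + δ) :=
    Real.summable_one_div_nat_rpow.2 (by linarith)
  refine ((summable_norm_iff.2 h1).add h2).of_nonneg_of_le (fun n ↦ by positivity) fun n ↦ ?_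
  rw [LSeries.norm_term_eq]
  split_ifs with hn
  · simp [hn, tau_zero]
    positivity
  · have hn' : (0 : ℝ) < n := by exact_mod_cast Nat.pos_of_ne_zero hn
    rw [norm_real, Real.norm_of_nonneg (sq_nonneg _), ofReal_re]
    have e1 : (n : ℝ) ^ (12 + δ) = (((n : ℝ) ^ ((12 + δ) / 2))) ^ 2 := by
      rw [← Real.rpow_natCast, ← Real.rpow_mul hn'.le]
      congr 1
      push_cast
      ring
    have e2 : (n : ℝ) ^ (1 + δ) = (((n : ℝ) ^ ((1 + δ) / 2))) ^ 2 := by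
      rw [← Real.rpow_natCast, ← Real.rpow_mul hn'.le]
      congr 1
      push_cast
      ring
    have e3 : (n : ℝ) ^ σ = (n : ℝ) ^ ((12 + δ) / 2) * (n : ℝ) ^ ((1 + δ) / 2) := by
      rw [← Real.rpow_add hn']
      congr 1
      rw [hδ]
      ring
    rw [e1, e2, e3, ← div_pow]
    set A := (n : ℝ) ^ ((12 + δ) / 2)
    set B := (n : ℝ) ^ ((1 + δ) / 2)
    have : ‖tau n‖ / (A * B) = ‖tau n‖ / A * (1 / B) := by rw [div_mul_div_comm, mul_one]
    rw [this, show 1 / B ^ 2 = (1 / B) ^ 2 by rw [div_pow, one_pow]]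
    nlinarith [sq_nonneg (‖tau n‖ / A - 1 / B), sq_nonneg (‖tau n‖ / A), sq_nonneg (1 / B)]

end TauTwist

/-! ### The twist of Δ and its inversion formula -/

namespace TauTwist

open Complex Set Filter Topology MeasureTheory

variable {D : ℕ} [NeZero D] (χ : DirichletCharacter ℂ D)

/-- The twist of `Δ` by `χ` on the imaginary axis, `t ↦ ∑ χ(n) τ(n) exp (-2 π n t / D)`. -/
noncomputable def twistedDelta (t : ℝ) : ℂ :=
  ∑' n : ℕ, χ n * tau n * (Real.exp (-(2 * Real.pi * n / D) * t) : ℝ)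

theorem summable_norm_tau_mul_exp {t : ℝ} (ht : 0 < t) :
    Summable fun n : ℕ ↦ ‖tau n‖ * Real.exp (-(2 * Real.pi * n / D) * t) := by
  have hD : (0 : ℝ) < D := by exact_mod_cast NeZero.pos D
  have hz : 0 < (I * (t / D : ℝ)).im := by
    rw [I_mul_im, ofReal_re]
    positivity
  refine (hasSum_tau hz).summable.norm.congr fun n ↦ ?_
  have : (2 * Real.pi * I * n * (I * (t / D : ℝ)) : ℂ) =
      ((-(2 * Real.pi * n / D) * t : ℝ) : ℂ) := by
    push_cast
    linear_combination (2 * Real.pi * n * (t / D) : ℂ) * I_sq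
  rw [this, ← ofReal_exp, norm_mul, norm_real, Real.norm_eq_abs, Real.abs_exp]

theorem norm_term_twistedDelta_le {D : ℕ} (χ : DirichletCharacter ℂ D) (n : ℕ) (t : ℝ) :
    ‖χ n * tau n * (Real.exp (-(2 * Real.pi * n / D) * t) : ℝ)‖ ≤
      ‖tau n‖ * Real.exp (-(2 * Real.pi * n / D) * t) := by
  rw [norm_mul, norm_mul, norm_real, Real.norm_eq_abs, Real.abs_exp]
  gcongr
  exact mul_le_of_le_one_left (norm_nonneg _) (χ.norm_le_one _)

theorem hasSum_twistedDelta {t : ℝ} (ht : 0 < t) :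
    HasSum (fun n : ℕ ↦ χ n * tau n * (Real.exp (-(2 * Real.pi * n / D) * t) : ℝ))
      (twistedDelta χ t) :=
  (Summable.of_norm_bounded (summable_norm_tau_mul_exp ht)
    fun n ↦ norm_term_twistedDelta_le χ n t).hasSum

/-- Since τ(0) = 0, every term decays from t = 1 on at least like exp(-2πt/D). -/
theorem exists_norm_twistedDelta_le : ∃ C c : ℝ, 0 ≤ C ∧ 0 < c ∧
    ∀ t : ℝ, 1 ≤ t → ‖twistedDelta χ t‖ ≤ C * Real.exp (-c * t) := by
  have hD : (0 : ℝ) < D := by exact_mod_cast NeZero.pos D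
  have hs := summable_norm_tau_mul_exp (D := D) one_pos
  set c := 2 * Real.pi / D with hc
  have hc0 : 0 < c := by positivity
  refine ⟨(∑' n : ℕ, ‖tau n‖ * Real.exp (-(2 * Real.pi * n / D) * 1)) * Real.exp c, c,
    mul_nonneg (tsum_nonneg fun n ↦ by positivity) (Real.exp_pos _).le, hc0, fun t ht ↦ ?_⟩
  have h := ((hs.mul_right (Real.exp (-c * (t - 1))))).hasSum
  rw [tsum_mul_right] at h
  refine (tsum_of_norm_bounded h fun n ↦ ?_).trans_eq ?_
  · refine (norm_term_twistedDelta_le χ n t).trans ?_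
    rcases eq_or_ne n 0 with rfl | hn
    · simp [tau_zero]
    · rw [mul_assoc ‖tau n‖ (Real.exp _), ← Real.exp_add]
      gcongr
      have h1 : (1 : ℝ) ≤ n := by exact_mod_cast Nat.one_le_iff_ne_zero.2 hn
      have h2 : 2 * Real.pi * n / D = n * c := by rw [hc]; ring
      rw [h2]
      nlinarith [mul_nonneg (mul_nonneg (sub_nonneg.2 h1) hc0.le) (sub_nonneg.2 ht)]
  · rw [mul_assoc _ (Real.exp _), ← Real.exp_add]
    congr 2
    ring

variable {χ}

/-- For primitive χ the discrete Fourier transform is a multiple of the Gauss sum; it is injective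
and χ(1) = 1. -/
theorem gaussSum_ne_zero (hχ : χ.IsPrimitive) : gaussSum χ (ZMod.stdAddChar (N := D)) ≠ 0 := by
  intro h
  have h0 : ZMod.dft (χ : ZMod D → ℂ) = 0 := by
    ext k
    rw [hχ.fourierTransform_eq_inv_mul_gaussSum, h, mul_zero, Pi.zero_apply]
  have h1 := congrFun ((LinearEquiv.map_eq_zero_iff _).1 h0) 1
  simp at h1

/-- Expanding χ(n) in additive characters turns the twist into values of Δ at points above the
fractions a/D, where modularity applies. -/
theorem gaussSum_mul_twistedDelta (hχ : χ.IsPrimitive) (hq : χ.IsQuadratic) {t : ℝ} (ht : 0 < t) :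
    gaussSum χ (ZMod.stdAddChar (N := D)) * twistedDelta χ t =
      ∑ a : ZMod D, χ a * ModularForm.eta ((a.val + I * t) / D) ^ 24 := by
  have hD : (0 : ℝ) < D := by exact_mod_cast NeZero.pos D
  have hD' : (D : ℂ) ≠ 0 := by exact_mod_cast hD.ne'
  have hz : ∀ a : ZMod D, 0 < ((a.val + I * t) / D : ℂ).im := by
    intro a
    rw [div_natCast_im, add_im, natCast_im, I_mul_im, ofReal_re, zero_add]
    positivity
  have h1 := hasSum_sum (s := Finset.univ) fun (a : ZMod D) _ ↦ (hasSum_tau (hz a)).mul_left (χ a)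
  refine ((hasSum_twistedDelta χ ht).mul_left _).unique ?_
  convert! h1 using 2 with n
  have h2 := gaussSum_mulShift_of_isPrimitive (ZMod.stdAddChar (N := D)) hχ (n : ZMod D)
  rw [hq.inv] at h2
  rw [mul_assoc, ← mul_assoc, mul_comm (gaussSum _ _), ← h2, gaussSum, Finset.sum_mul]
  refine Finset.sum_congr rfl fun a _ ↦ ?_
  have h3 : (n : ZMod D) * a = ((n * a.val : ℤ) : ZMod D) := by simp
  rw [AddChar.mulShift_apply, h3, ZMod.stdAddChar_coe]
  have h4 : exp (2 * Real.pi * I * n * ((a.val + I * t) / D)) =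
      exp (2 * Real.pi * I * (n * a.val : ℤ) / D) *
        (Real.exp (-(2 * Real.pi * n / D) * t) : ℝ) := by
    rw [ofReal_exp, ← Complex.exp_add]
    congr 1
    push_cast
    field_simp
    linear_combination (n * t : ℂ) * I_sq
  rw [h4]
  ring

/-- With α ≡ -a⁻¹ mod D, the matrix (α, β; D, -a) has determinant 1 and sends (a + it)/D to (α +
i/t)/D. The automorphy factor is it, and i^12 = 1. -/
theorem eta_pow_inversion (u : (ZMod D)ˣ) {t : ℝ} (ht : 0 < t) :
    ModularForm.eta ((((-u⁻¹ : (ZMod D)ˣ) : ZMod D).val + I * (1 / t : ℝ)) / D) ^ 24 =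
      t ^ 12 * ModularForm.eta (((u : ZMod D).val + I * t) / D) ^ 24 := by
  have hD : (0 : ℝ) < D := by exact_mod_cast NeZero.pos D
  have hD' : (D : ℂ) ≠ 0 := by exact_mod_cast hD.ne'
  have ht' : (t : ℂ) ≠ 0 := by exact_mod_cast ht.ne'
  set a : ℤ := ((u : ZMod D).val : ℤ) with ha
  set α : ℤ := (((-u⁻¹ : (ZMod D)ˣ) : ZMod D).val : ℤ) with hα
  obtain ⟨β, hβ⟩ : (D : ℤ) ∣ -1 - α * a := by
    rw [← ZMod.intCast_zmod_eq_zero_iff_dvd]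
    simp [ha, hα]
  have hz : 0 < ((a + I * t) / D : ℂ).im := by
    rw [div_natCast_im, add_im, intCast_im, I_mul_im, ofReal_re, zero_add]
    positivity
  have h := ModularForm.eta_pow_moebius (a := α) (b := β) (c := D) (d := -a)
    (by linear_combination hβ) hz
  have hβ' : (-1 - α * a : ℂ) = D * β := by exact_mod_cast hβ
  have e1 : ((D : ℤ) : ℂ) * ((a + I * t) / D) + (-a : ℤ) = I * t := by
    push_cast
    field_simp
    ring
  have e2 : (α * ((a + I * t) / D) + β : ℂ) / (I * t) = (α + I * (1 / t : ℝ)) / D := by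
    push_cast
    field_simp
    linear_combination (-1 : ℂ) * hβ' - I_sq
  rw [e1, e2] at h
  have e3 : (I * t : ℂ) ^ 12 = t ^ 12 := by
    rw [mul_pow, show (12 : ℕ) = 4 * 3 by norm_num, pow_mul, I_pow_four, one_pow, one_mul]
  rw [e3] at h
  simpa [ha, hα] using h

/-- Inversion permutes the units by u ↦ -u⁻¹, which preserves χ because χ is quadratic and even. The
same Gauss sum occurs on both sides and cancels, so its value is never needed. -/
theorem twistedDelta_one_div (hχ : χ.IsPrimitive) (hq : χ.IsQuadratic) (heven : χ (-1) = 1)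
    {t : ℝ} (ht : 0 < t) : twistedDelta χ (1 / t) = t ^ 12 * twistedDelta χ t := by
  have hunits : ∀ f : ZMod D → ℂ, ∑ a, χ a * f a = ∑ u : (ZMod D)ˣ, χ u * f u := by
    intro f
    refine (Fintype.sum_of_injective (Units.val) Units.val_injective _ _ ?_ fun _ ↦ rfl).symm
    intro a ha
    rw [χ.map_nonunit fun ⟨u, hu⟩ ↦ ha ⟨u, hu⟩, zero_mul]
  apply mul_left_cancel₀ (gaussSum_ne_zero hχ)
  rw [gaussSum_mul_twistedDelta hχ hq (by positivity), mul_left_comm,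
    gaussSum_mul_twistedDelta hχ hq ht, hunits, hunits, Finset.mul_sum]
  refine (Fintype.sum_equiv ((Equiv.inv _).trans (Equiv.neg _)) _ _ fun u ↦ ?_).symm
  have h1 : χ ((-u⁻¹ : (ZMod D)ˣ) : ZMod D) = χ u := by
    have h2 : χ ((u⁻¹ : (ZMod D)ˣ) : ZMod D) = χ⁻¹ u := (MulChar.inv_apply_eq_inv' χ _).symm ▸ by
      rw [map_units_inv χ u]
    rw [Units.val_neg, ← neg_one_mul, map_mul, heven, one_mul, h2, hq.inv]
  change _ = χ ((-u⁻¹ : (ZMod D)ˣ) : ZMod D) * ModularForm.eta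
    ((((-u⁻¹ : (ZMod D)ˣ) : ZMod D).val + I * (1 / t : ℝ)) / D) ^ 24
  rw [h1, eta_pow_inversion u ht]
  ring

theorem continuousOn_twistedDelta (hχ : χ.IsPrimitive) (hq : χ.IsQuadratic) :
    ContinuousOn (twistedDelta χ) (Ioi 0) := by
  have hD : (0 : ℝ) < D := by exact_mod_cast NeZero.pos D
  have h : ContinuousOn (fun t : ℝ ↦ (gaussSum χ (ZMod.stdAddChar (N := D)))⁻¹ *
      ∑ a : ZMod D, χ a * ModularForm.eta ((a.val + I * t) / D) ^ 24) (Ioi 0) := by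
    refine continuousOn_const.mul (continuousOn_finsetSum _ fun a _ ↦ continuousOn_const.mul ?_)
    refine continuousOn_eta_pow.comp (f := fun t : ℝ ↦ ((a.val + I * t) / D : ℂ))
      (by fun_prop) fun t ht ↦ ?_
    have ht : 0 < t := ht
    rw [mem_ofPred_eq, div_natCast_im, add_im, natCast_im, I_mul_im, ofReal_re, zero_add]
    positivity
  refine h.congr fun t ht ↦ ?_
  simp only
  rw [← gaussSum_mul_twistedDelta hχ hq ht, inv_mul_cancel_left₀ (gaussSum_ne_zero hχ)]

end TauTwist

/-! ### Mellin transforms: functional equation and growth -/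

open Complex Set Filter Topology MeasureTheory Asymptotics in
/-- A function on `(0, ∞)` with `f (1 / t) = t ^ k * f t` and exponential decay, as a strong
FE-pair. -/
theorem exists_isStrongFEPair {f : ℝ → ℂ} (hf : ContinuousOn f (Ioi 0)) {C c : ℝ} (hc : 0 < c)
    (hbound : ∀ t, 1 ≤ t → ‖f t‖ ≤ C * Real.exp (-c * t)) {k : ℕ} (hk : 0 < k)
    (hFE : ∀ t : ℝ, 0 < t → f (1 / t) = t ^ k * f t) :
    ∃ P : WeakFEPair ℂ, IsStrongFEPair P ∧ P.f = f ∧ P.g = f ∧ P.k = k ∧ P.ε = 1 := by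
  have hloc : LocallyIntegrableOn f (Ioi 0) := hf.locallyIntegrableOn measurableSet_Ioi
  have htop : ∀ r : ℝ, (f · - 0) =O[atTop] (· ^ r : ℝ → ℝ) := by
    intro r
    simp only [sub_zero]
    have h1 : f =O[atTop] fun t ↦ Real.exp (-c * t) := by
      refine IsBigO.of_bound C ?_
      filter_upwards [eventually_ge_atTop 1] with t ht
      rw [Real.norm_eq_abs, Real.abs_exp]
      exact hbound t ht
    exact h1.trans (isLittleO_exp_neg_mul_rpow_atTop hc r).isBigO
  refine ⟨⟨f, f, k, 1, 0, 0, hloc, hloc, by exact_mod_cast hk, one_ne_zero, fun x hx ↦ ?_,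
    htop, htop⟩, ⟨rfl, rfl⟩, rfl, rfl, rfl, rfl⟩
  rw [hFE x hx, Real.rpow_natCast, one_mul, smul_eq_mul, ofReal_pow]

namespace Mellin

open Complex Set Filter Topology MeasureTheory

/-- From log t ≤ 2√t and completing the square. The quadratic exponent is wasteful compared with
Stirling, but growth of order two is all that the contour argument needs. -/
theorem rpow_le_exp_mul_exp {c : ℝ} (hc : 0 < c) (x : ℝ) {t : ℝ} (ht : 1 ≤ t) :
    t ^ x ≤ Real.exp (2 / c * x ^ 2) * Real.exp (c / 2 * t) := by
  have ht0 : 0 < t := by linarith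
  rw [Real.rpow_def_of_pos ht0, ← Real.exp_add, Real.exp_le_exp]
  have h1 : Real.log t ≤ 2 * √t := by
    have h2 := Real.log_le_sub_one_of_pos (Real.sqrt_pos.2 ht0)
    rw [Real.log_sqrt ht0.le] at h2
    linarith
  have h3 : Real.log t * x ≤ 2 * √t * |x| :=
    (mul_le_mul_of_nonneg_left (le_abs_self x) (Real.log_nonneg ht)).trans
      (mul_le_mul_of_nonneg_right h1 (abs_nonneg x))
  have h4 : 2 * √t * |x| ≤ 2 / c * x ^ 2 + c / 2 * t := by
    have h5 : 0 ≤ 2 / c * (|x| - c / 2 * √t) ^ 2 := by positivity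
    have h6 : 2 / c * (|x| - c / 2 * √t) ^ 2 =
        2 / c * |x| ^ 2 - 2 * √t * |x| + c / 2 * (√t) ^ 2 := by
      field_simp
      ring
    rw [h6, sq_abs, Real.sq_sqrt ht0.le] at h5
    linarith
  linarith

/-- For t ≤ 1 the substitution u = 1/t and the functional equation turn the exponent into k + 1 - Re
s, so decay at infinity also controls 0. The factor exp(c/2) makes one integrable majorant serve all
t > 0. -/
theorem norm_cpow_smul_le {f : ℝ → ℂ} {C c : ℝ} (hC : 0 ≤ C) (hc : 0 < c)
    (hbound : ∀ t, 1 ≤ t → ‖f t‖ ≤ C * Real.exp (-c * t)) {k : ℕ}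
    (hFE : ∀ t : ℝ, 0 < t → f (1 / t) = t ^ k * f t) (s : ℂ) {t : ℝ} (ht : 0 < t) :
    ‖(t : ℂ) ^ (s - 1) • f t‖ ≤ C * Real.exp (c / 2) *
      Real.exp (2 / c * ((k + 1) * (1 + ‖s‖)) ^ 2) * Real.exp (-(c / 2) * t) := by
  have hre := abs_le.1 (abs_re_le_norm s)
  have hs0 := norm_nonneg s
  have key : ∀ x u : ℝ, |x| ≤ (k + 1) * (1 + ‖s‖) → 1 ≤ u → u ^ x * ‖f u‖ ≤
      C * Real.exp (2 / c * ((k + 1) * (1 + ‖s‖)) ^ 2) * Real.exp (-(c / 2) * u) := by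
    intro x u hx hu
    calc u ^ x * ‖f u‖ ≤ (Real.exp (2 / c * x ^ 2) * Real.exp (c / 2 * u)) *
          (C * Real.exp (-c * u)) := by
          gcongr
          exacts [rpow_le_exp_mul_exp hc x hu, hbound u hu]
      _ = C * Real.exp (2 / c * x ^ 2) * (Real.exp (c / 2 * u) * Real.exp (-c * u)) := by ring
      _ ≤ _ := by
          rw [← Real.exp_add]
          gcongr ?_ * Real.exp (2 / c * ?_) * Real.exp ?_
          · exact sq_le_sq.2 (hx.trans (le_abs_self _))
          · linarith
  have hnorm : ‖(t : ℂ) ^ (s - 1) • f t‖ = t ^ (s.re - 1) * ‖f t‖ := by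
    rw [norm_smul, norm_cpow_eq_rpow_re_of_pos ht, sub_re, one_re]
  have hk0 : (0 : ℝ) ≤ k := k.cast_nonneg
  have hE : 0 ≤ C * Real.exp (2 / c * ((k + 1) * (1 + ‖s‖)) ^ 2) := by positivity
  rw [hnorm]
  rcases le_total 1 t with h1 | h1
  · refine (key (s.re - 1) t ?_ h1).trans ?_
    · rw [abs_le]
      constructor <;> nlinarith
    · have : 1 ≤ Real.exp (c / 2) := Real.one_le_exp (by positivity)
      have h2 := mul_le_mul_of_nonneg_left this
        (mul_nonneg hE (Real.exp_pos (-(c / 2) * t)).le)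
      linarith
  · have hu : 1 ≤ 1 / t := by rwa [le_div_iff₀ ht, one_mul]
    have h3 := hFE (1 / t) (by positivity)
    rw [one_div_one_div] at h3
    have h4 : t ^ (s.re - 1) * ‖f t‖ = (1 / t) ^ ((k : ℝ) + 1 - s.re) * ‖f (1 / t)‖ := by
      rw [h3, norm_mul, norm_pow, norm_real, Real.norm_of_nonneg (by positivity : 0 ≤ 1 / t),
        ← mul_assoc, ← Real.rpow_natCast]
      congr 1
      rw [one_div, Real.inv_rpow ht.le, Real.inv_rpow ht.le, ← Real.rpow_neg ht.le,
        ← Real.rpow_neg ht.le, ← Real.rpow_add ht]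
      congr 1
      ring
    rw [h4]
    refine (key _ _ ?_ hu).trans ?_
    · rw [abs_le]
      constructor <;> nlinarith
    · have h5 : Real.exp (-(c / 2) * (1 / t)) ≤ Real.exp (c / 2) * Real.exp (-(c / 2) * t) := by
        rw [← Real.exp_add, Real.exp_le_exp]
        have : 0 ≤ c / 2 * (1 / t) := by positivity
        nlinarith
      have h2 := mul_le_mul_of_nonneg_left h5 hE
      linarith

theorem exists_norm_mellin_le {f : ℝ → ℂ} {C c : ℝ} (hC : 0 ≤ C) (hc : 0 < c)
    (hbound : ∀ t, 1 ≤ t → ‖f t‖ ≤ C * Real.exp (-c * t)) {k : ℕ}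
    (hFE : ∀ t : ℝ, 0 < t → f (1 / t) = t ^ k * f t) :
    ∃ M B : ℝ, 0 ≤ M ∧ 0 ≤ B ∧ ∀ s, ‖mellin f s‖ ≤ M * Real.exp (B * (1 + ‖s‖) ^ 2) := by
  refine ⟨C * Real.exp (c / 2) * ∫ t in Ioi (0 : ℝ), Real.exp (-(c / 2) * t),
    2 / c * (k + 1) ^ 2, mul_nonneg (by positivity) (by positivity), by positivity, fun s ↦ ?_⟩
  have h := norm_integral_le_of_norm_le
    ((exp_neg_integrableOn_Ioi 0 (half_pos hc)).const_mul (C * Real.exp (c / 2) *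
      Real.exp (2 / c * ((k + 1) * (1 + ‖s‖)) ^ 2)))
    ((ae_restrict_iff' measurableSet_Ioi).2 (.of_forall fun t ht ↦
      norm_cpow_smul_le hC hc hbound hFE s ht))
  rw [integral_const_mul] at h
  refine h.trans_eq ?_
  rw [mul_pow, ← mul_assoc (2 / c)]
  ring

end Mellin

/-! ### The completed twisted L-function -/

namespace TauTwist

open Complex Set Filter Topology MeasureTheory

variable {D : ℕ} [NeZero D] {χ : DirichletCharacter ℂ D}

/-- The completed `L`-function of the twist of `Δ` by `χ`, as an entire function. -/
noncomputable def completedTwist (χ : DirichletCharacter ℂ D) (s : ℂ) : ℂ :=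
  ((D : ℂ) / (2 * Real.pi)) ^ (-(11 / 2) : ℂ) * mellin (twistedDelta χ) (s + 11 / 2)

section

variable (hχ : χ.IsPrimitive) (hq : χ.IsQuadratic) (heven : χ (-1) = 1)
include hχ hq heven

/-- Weight 12 gives the symmetry w ↦ 12 - w; for w = s + 11/2 this is s ↦ 1 - s. -/
theorem differentiable_completedTwist_and_one_sub : Differentiable ℂ (completedTwist χ) ∧
    ∀ s, completedTwist χ (1 - s) = completedTwist χ s := by
  obtain ⟨C, c, -, hc, hb⟩ := exists_norm_twistedDelta_le χ
  obtain ⟨P, hP, hf, hg, hk, hε⟩ := exists_isStrongFEPair (continuousOn_twistedDelta hχ hq) hc hb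
    (k := 12) (by norm_num) fun t ht ↦ twistedDelta_one_div hχ hq heven ht
  have h1 := hP.differentiable_Λ
  rw [hP.Λ_eq, hf] at h1
  refine ⟨(h1.comp (by fun_prop : Differentiable ℂ fun s : ℂ ↦ s + 11 / 2)).const_mul _,
    fun s ↦ ?_⟩
  have h2 := P.functional_equation (s + 11 / 2)
  rw [hP.Λ_eq, hP.symm_Λ_eq, hf, hg, hk, hε, one_smul] at h2
  rw [completedTwist, completedTwist, ← h2]
  congr 2
  push_cast
  ring

theorem exists_norm_completedTwist_le :
    ∃ A : ℝ, ∀ s, ‖completedTwist χ s‖ ≤ Real.exp (A * (1 + ‖s‖) ^ 2) := by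
  obtain ⟨C, c, hC, hc, hb⟩ := exists_norm_twistedDelta_le χ
  obtain ⟨M, B, hM, hB, h⟩ := Mellin.exists_norm_mellin_le hC hc hb (k := 12)
    fun t ht ↦ twistedDelta_one_div hχ hq heven ht
  set K := ‖((D : ℂ) / (2 * Real.pi)) ^ (-(11 / 2) : ℂ)‖ with hK
  -- The prefactor is absorbed through KM ≤ exp(KM(1 + ‖s‖)^2); the 7 bounds the shift by 11/2.
  refine ⟨K * M + B * 7 ^ 2, fun s ↦ ?_⟩
  have h1 : 1 + ‖s + 11 / 2‖ ≤ 7 * (1 + ‖s‖) := by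
    have := norm_add_le s (11 / 2)
    rw [show ‖(11 / 2 : ℂ)‖ = 11 / 2 by norm_num] at this
    linarith [norm_nonneg s]
  calc ‖completedTwist χ s‖ ≤ K * (M * Real.exp (B * (1 + ‖s + 11 / 2‖) ^ 2)) := by
        rw [completedTwist, norm_mul]
        gcongr
        exact h _
    _ ≤ K * (M * Real.exp (B * (7 * (1 + ‖s‖)) ^ 2)) := by gcongr
    _ = (K * M) * Real.exp (B * (7 * (1 + ‖s‖)) ^ 2) := by ring
    _ ≤ Real.exp (K * M * (1 + ‖s‖) ^ 2) * Real.exp (B * (7 * (1 + ‖s‖)) ^ 2) := by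
        gcongr
        have h2 : 1 ≤ (1 + ‖s‖) ^ 2 := one_le_pow₀ (by linarith [norm_nonneg s])
        have h3 : 0 ≤ K * M := by positivity
        calc K * M ≤ K * M * (1 + ‖s‖) ^ 2 := le_mul_of_one_le_right h3 h2
          _ ≤ _ := by linarith [Real.add_one_le_exp (K * M * (1 + ‖s‖) ^ 2)]
    _ = _ := by
        rw [← Real.exp_add]
        congr 1
        ring

end

/-- Termwise Mellin transformation gives Γ(s + 11/2)(2πn/D)^(-s-11/2); the prefactor of
`completedTwist` and the normalization of `tauStar` cancel the powers 11/2. -/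
theorem completedTwist_eq_of_one_lt_re {d : ℤ} (hd : (D : ℤ) = d)
    (hk : ∀ n : ℕ, (kroneckerSymbol d n : ℂ) = χ n) {s : ℂ} (hs : 1 < s.re) :
    completedTwist χ s =
      ((d : ℂ) / (2 * Real.pi)) ^ s * Gamma (s + 11 / 2) * twistedTauSeries d s := by
  have hD : (0 : ℝ) < D := by exact_mod_cast NeZero.pos D
  have hre : (s + 11 / 2).re = s.re + 11 / 2 := by
    rw [add_re, show (11 / 2 : ℂ) = ((11 / 2 : ℝ) : ℂ) by push_cast; ring, ofReal_re]
  have hp : ∀ n : ℕ, n ≠ 0 → 0 < 2 * Real.pi * n / D := by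
    intro n hn
    have : (0 : ℝ) < n := by exact_mod_cast Nat.pos_of_ne_zero hn
    positivity
  have h := hasSum_mellin (a := fun n : ℕ ↦ χ n * tau n) (p := fun n : ℕ ↦ 2 * Real.pi * n / D)
    (F := twistedDelta χ) (s := s + 11 / 2) (fun n ↦ ?_) (by rw [hre]; linarith)
    (fun t ht ↦ hasSum_twistedDelta χ ht) ?_
  · have hD' : (D : ℂ) / (2 * Real.pi) ≠ 0 := by
      have h1 : (D : ℂ) ≠ 0 := by exact_mod_cast hD.ne'
      have h2 : (Real.pi : ℂ) ≠ 0 := by exact_mod_cast Real.pi_ne_zero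
      exact div_ne_zero h1 (mul_ne_zero two_ne_zero h2)
    rw [completedTwist, ← h.tsum_eq, twistedTauSeries, LSeries, ← tsum_mul_left, ← tsum_mul_left]
    congr 1 with n
    rcases eq_or_ne n 0 with rfl | hn
    · simp [tau_zero]
    have hn' : (0 : ℝ) < n := by exact_mod_cast Nat.pos_of_ne_zero hn
    have hnC : (n : ℂ) ≠ 0 := by exact_mod_cast hn
    rw [LSeries.term_of_ne_zero hn, hk, tauStar, ← hd]
    have e1 : ((2 * Real.pi * n / D : ℝ) : ℂ) ^ (s + 11 / 2) =
        (((D : ℂ) / (2 * Real.pi)) ^ (s + 11 / 2))⁻¹ * ((n : ℂ) ^ s * (n : ℂ) ^ (11 / 2 : ℂ)) := by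
      have : (2 * Real.pi * n / D : ℝ) = (D / (2 * Real.pi))⁻¹ * n := by
        field_simp
      rw [this, ofReal_mul, mul_cpow_ofReal_nonneg (by positivity) hn'.le, ofReal_natCast,
        ← cpow_add _ _ hnC, ofReal_inv, inv_cpow]
      · push_cast
        rfl
      · rw [arg_ofReal_of_nonneg (by positivity)]
        exact Real.pi_pos.ne
    have e2 : ((D : ℂ) / (2 * Real.pi)) ^ s = ((D : ℂ) / (2 * Real.pi)) ^ (-(11 / 2) : ℂ) *
        ((D : ℂ) / (2 * Real.pi)) ^ (s + 11 / 2) := by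
      rw [← cpow_add _ _ hD']
      congr 1
      ring
    have e3 : (n : ℂ) ^ s ≠ 0 := by simp [cpow_eq_zero_iff, hnC]
    have e4 : (n : ℂ) ^ (11 / 2 : ℂ) ≠ 0 := by simp [cpow_eq_zero_iff, hnC]
    have e5 : ((D : ℂ) / (2 * Real.pi)) ^ (s + 11 / 2) ≠ 0 := by
      rw [Ne, cpow_eq_zero_iff]
      tauto
    rw [e1, Int.cast_natCast, e2]
    field_simp
  · rcases eq_or_ne n 0 with rfl | hn
    · exact Or.inl (by simp [tau_zero])
    · exact Or.inr (hp n hn)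
  · rw [hre]
    have h1 := (summable_norm_tau_div (σ := s.re + 11 / 2) (by linarith)).mul_left
      (((2 * Real.pi / D : ℝ) ^ (s.re + 11 / 2))⁻¹)
    refine h1.of_nonneg_of_le (fun n ↦ by positivity) fun n ↦ ?_
    have e1 : (2 * Real.pi * n / D : ℝ) ^ (s.re + 11 / 2) =
        (2 * Real.pi / D : ℝ) ^ (s.re + 11 / 2) * (n : ℝ) ^ (s.re + 11 / 2) := by
      rw [← Real.mul_rpow (by positivity) (by positivity)]
      congr 1
      ring
    have e2 : ‖χ n * tau n‖ ≤ ‖tau n‖ := by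
      rw [norm_mul]
      exact mul_le_of_le_one_left (norm_nonneg _) (χ.norm_le_one _)
    rw [e1, ← div_eq_inv_mul, div_div, mul_comm ((n : ℝ) ^ _)]
    gcongr

end TauTwist

/-! ### Identification of ξ with the completed function -/

namespace TauTwist

open Complex Set Filter Topology MeasureTheory

theorem IsGammaPole.re_le {s : ℂ} (h : IsGammaPole s) : s.re ≤ -(11 / 2) := by
  obtain ⟨n, hn⟩ := h
  have := congrArg re hn
  rw [add_re, neg_re, natCast_re, show (11 / 2 : ℂ) = ((11 / 2 : ℝ) : ℂ) by push_cast; ring,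
    ofReal_re] at this
  linarith [n.cast_nonneg (α := ℝ)]

section

variable {D : ℕ} [NeZero D] {χ : DirichletCharacter ℂ D} (hχ : χ.IsPrimitive)
  (hq : χ.IsQuadratic) (heven : χ (-1) = 1) {d : ℤ} (hd : (D : ℤ) = d)
  (hk : ∀ n : ℕ, (kroneckerSymbol d n : ℂ) = χ n)
include hχ hq heven hd hk

/-- As 1/Γ is entire, so is the right side, and it equals the Dirichlet series for Re s > 1. This
shows that the continuation exists, and the identity theorem makes the chosen one equal to it
everywhere. -/
theorem twistedTauL_eq (s : ℂ) : twistedTauL d s =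
    completedTwist χ s * (((d : ℂ) / (2 * Real.pi)) ^ s)⁻¹ * (Gamma (s + 11 / 2))⁻¹ := by
  have hd0 : (d : ℂ) / (2 * Real.pi) ≠ 0 := by
    have h1 : (d : ℂ) ≠ 0 := by
      rw [← hd]
      exact_mod_cast NeZero.ne D
    have h2 : (Real.pi : ℂ) ≠ 0 := by exact_mod_cast Real.pi_ne_zero
    exact div_ne_zero h1 (mul_ne_zero two_ne_zero h2)
  have hpow : ∀ s : ℂ, ((d : ℂ) / (2 * Real.pi)) ^ s ≠ 0 := fun s ↦ by
    rw [Ne, cpow_eq_zero_iff]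
    tauto
  have hdiff : Differentiable ℂ fun s : ℂ ↦
      completedTwist χ s * (((d : ℂ) / (2 * Real.pi)) ^ s)⁻¹ * (Gamma (s + 11 / 2))⁻¹ := by
    refine ((differentiable_completedTwist_and_one_sub hχ hq heven).1.mul ?_).mul ?_
    · exact Differentiable.inv (fun s ↦ differentiableAt_id.const_cpow (Or.inl hd0)) hpow
    · exact differentiable_one_div_Gamma.comp (by fun_prop : Differentiable ℂ fun s : ℂ ↦ s + 11 / 2)
  have heq : ∀ s : ℂ, 1 < s.re → completedTwist χ s * (((d : ℂ) / (2 * Real.pi)) ^ s)⁻¹ *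
      (Gamma (s + 11 / 2))⁻¹ = twistedTauSeries d s := by
    intro s hs
    have hG : Gamma (s + 11 / 2) ≠ 0 := by
      apply Gamma_ne_zero_of_re_pos
      rw [add_re, show (11 / 2 : ℂ) = ((11 / 2 : ℝ) : ℂ) by push_cast; ring, ofReal_re]
      linarith
    rw [completedTwist_eq_of_one_lt_re hd hk hs]
    have hp := hpow s
    generalize Gamma (s + 11 / 2) = G at hG ⊢
    field_simp
  have hex : ∃ F : ℂ → ℂ, Differentiable ℂ F ∧ ∀ s : ℂ, 1 < s.re → F s = twistedTauSeries d s :=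
    ⟨_, hdiff, heq⟩
  rw [twistedTauL, dif_pos hex]
  obtain ⟨h1, h2⟩ := hex.choose_spec
  refine congrFun (AnalyticOnNhd.eq_of_eventuallyEq (z₀ := 2) (fun z _ ↦ h1.analyticAt z)
    (fun z _ ↦ hdiff.analyticAt z) ?_) s
  filter_upwards [(isOpen_lt continuous_const continuous_re).mem_nhds
    (show (1 : ℝ) < (2 : ℂ).re by norm_num)] with z hz
  rw [h2 z hz, heq z hz]

theorem xi_eq_completedTwist {s : ℂ} (hs : ¬ IsGammaPole s) : xi d s = completedTwist χ s := by
  have hG : Gamma (s + 11 / 2) ≠ 0 := Gamma_ne_zero fun n hn ↦ hs ⟨n, hn⟩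
  have hpow : ((d : ℂ) / (2 * Real.pi)) ^ s ≠ 0 := by
    have h1 : (d : ℂ) ≠ 0 := by
      rw [← hd]
      exact_mod_cast NeZero.ne D
    have h2 : (Real.pi : ℂ) ≠ 0 := by exact_mod_cast Real.pi_ne_zero
    rw [Ne, cpow_eq_zero_iff]
    exact fun h ↦ div_ne_zero h1 (mul_ne_zero two_ne_zero h2) h.1
  rw [xi, twistedTauL_eq hχ hq heven hd hk]
  generalize Gamma (s + 11 / 2) = G at hG ⊢
  field_simp

theorem xi_eventuallyEq_completedTwist {s : ℂ} (hs : 0 < s.re) : xi d =ᶠ[𝓝 s] completedTwist χ := by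
  filter_upwards [(isOpen_lt continuous_const continuous_re).mem_nhds hs] with z hz
  refine xi_eq_completedTwist hχ hq heven hd hk fun h ↦ ?_
  have h1 := h.re_le
  have h2 : 0 < z.re := hz
  linarith

/-- The hypothesis is silent at gamma poles, but these have Re s ≤ -11/2. A zero there would reflect
to one with Re s ≥ 13/2, away from the poles, which the hypothesis excludes. -/
theorem completedTwist_zero_re (hRH : RiemannHypothesisFor d) {s : ℂ}
    (hs : completedTwist χ s = 0) : s.re = 1 / 2 := by
  by_cases hp : IsGammaPole s
  · have h1 : ¬ IsGammaPole (1 - s) := fun h ↦ by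
      have h2 := h.re_le
      have h3 := hp.re_le
      rw [sub_re, one_re] at h2
      linarith
    have h4 := hRH (1 - s) h1 (by
      rw [xi_eq_completedTwist hχ hq heven hd hk h1,
        (differentiable_completedTwist_and_one_sub hχ hq heven).2, hs])
    rw [sub_re, one_re] at h4
    linarith
  · exact hRH s hp (by rw [xi_eq_completedTwist hχ hq heven hd hk hp, hs])

end

end TauTwist

/-! ### The explicit formula for the twisted L-function -/

open TauTwist Complex MeasureTheory in
theorem theorem2p1 (d : ℤ) (hd : TauTwist.IsFundamentalDiscriminant d) (hd_pos : 0 < d)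
    (hGRH : TauTwist.RiemannHypothesisFor d)
    (φ : SchwartzMap ℝ ℂ) (hφ_even : ∀ x : ℝ, φ (-x) = φ x)
    (hφ_supp : HasCompactSupport (FourierTransform.fourier φ : SchwartzMap ℝ ℂ)) :
    -- the line integral converges absolutely and no zero of the denominator lies on the line
    (∀ t : ℝ, TauTwist.xi d (((3 / 2 : ℝ) : ℂ) + (t : ℂ) * Complex.I) ≠ 0) ∧
    MeasureTheory.Integrable (fun t : ℝ ↦
      TauTwist.explicitIntegrand d φ (((3 / 2 : ℝ) : ℂ) + (t : ℂ) * Complex.I)) ∧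
    -- the sum over zeros, counted with multiplicity, converges absolutely to the integral
    HasSum (fun γ : TauTwist.zeroOrdinates d ↦
        (TauTwist.zeroMultiplicity d (γ : ℝ) : ℂ) * φ (γ : ℝ))
      (1 / (2 * (Real.pi : ℂ) * Complex.I) *
        TauTwist.verticalIntegral (3 / 2) (TauTwist.explicitIntegrand d φ)) := by
  obtain ⟨D, hD0, hD, χ, hχ, hq, heven, hk⟩ := exists_primitive_character hd hd_pos
  have : NeZero D := ⟨hD0⟩
  obtain ⟨hdiff, hFE⟩ := differentiable_completedTwist_and_one_sub hχ hq heven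
  obtain ⟨A, hA⟩ := exists_norm_completedTwist_le hχ hq heven
  have hline : ∀ z, completedTwist χ z = 0 → z.re = 1 / 2 :=
    fun z ↦ completedTwist_zero_re hχ hq heven hD hk hGRH
  -- Any point off the critical line would do as centre for the factorizations.
  have hc : completedTwist χ 2 ≠ 0 := fun h ↦ by
    have := hline 2 h
    norm_num at this
  obtain ⟨C, hC⟩ := exists_norm_weightH_le hφ_supp 6
  have hre : ∀ t : ℝ, (((3 / 2 : ℝ) : ℂ) + (t : ℂ) * I).re = 3 / 2 := fun t ↦ by simp
  have hre' : ∀ t : ℝ, (1 / 2 + (t : ℂ) * I).re = 1 / 2 := fun t ↦ by simp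
  have hcongr : ∀ t : ℝ, explicitIntegrand d φ (((3 / 2 : ℝ) : ℂ) + (t : ℂ) * I) =
      2 * (weightH φ (((3 / 2 : ℝ) : ℂ) + (t : ℂ) * I) *
        logDeriv (completedTwist χ) (((3 / 2 : ℝ) : ℂ) + (t : ℂ) * I)) := by
    intro t
    have h := xi_eventuallyEq_completedTwist hχ hq heven hD hk
      (s := ((3 / 2 : ℝ) : ℂ) + (t : ℂ) * I) (by rw [hre]; norm_num)
    rw [explicitIntegrand, weightH_one_sub hφ_even, h.deriv_eq, h.eq_of_nhds, logDeriv_apply]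
    ring
  refine ⟨fun t h ↦ ?_, ?_, ?_⟩
  · have h1 := hGRH _ (fun hp ↦ ?_) h
    · rw [hre] at h1
      norm_num at h1
    · have := hp.re_le
      rw [hre] at this
      norm_num at this
  · simp only [hcongr]
    exact (EntireFunction.integrable_mul_logDeriv hdiff hc hA hline
      (differentiable_weightH hφ_supp) hC).const_mul 2
  · have h := EntireFunction.hasSum_zeros hdiff hc hA hline hFE (differentiable_weightH hφ_supp)
      (weightH_one_sub hφ_even) hC
    -- Equality near each point, not only at it, is needed to transfer multiplicities.
    have hloc : ∀ γ : ℝ, xi d =ᶠ[nhds (1 / 2 + (γ : ℂ) * I)] completedTwist χ := fun γ ↦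
      xi_eventuallyEq_completedTwist hχ hq heven hD hk (by rw [hre']; norm_num)
    have hset : zeroOrdinates d = {γ : ℝ | completedTwist χ (1 / 2 + γ * I) = 0} := by
      ext γ
      change xi d _ = 0 ↔ completedTwist χ _ = 0
      rw [(hloc γ).eq_of_nhds]
    rw [hset]
    convert! h using 1
    · ext γ
      rw [zeroMultiplicity, analyticOrderNatAt, analyticOrderNatAt, analyticOrderAt_congr (hloc γ),
        weightH_half_add]
    · rw [verticalIntegral]
      simp only [hcongr]
      rw [integral_mul_const, integral_const_mul]
      have : (Real.pi : ℂ) ≠ 0 := by exact_mod_cast Real.pi_ne_zero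
      field_simp
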